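/- Let $k\ge 1$ and $r\ge 3$ be integers. The clique-path $P_{k,r}$ is the graph with vertices $p_1,\dots,p_{k+1}$ and $c_{i,j}$ ($1\le i\le k$, $1\le j\le r-2$), whose edges are $p_ip_{i+1}$, $p_ic_{i,j}$, $p_{i+1}c_{i,j}$ for $1\le i\le k$, $1\le j\le r-2$, and $c_{i,a}c_{i,b}$ for $1\le i\le k$, $1\le a<b\le r-2$; that is, a path with $k$ edges in which each edge is extended to an $r$-clique by new vertices. A graph is $P_{k,r}$-free if it contains no (not necessarily induced) subgraph isomorphic to $P_{k,r}$. Let $f=\lfloor (k-1)/2\rfloor$. For $n$ large, let $T_{n-f,r-1}$ be the complete $(r-1)$-partite graph on $n-f$ vertices whose part sizes differ by at most one, and let $K_f\vee T_{n-f,r-1}$ be its join with a clique on $f$ vertices. If $k$ is odd, a $G_{n,k,r}$ is the graph $K_f\vee T_{n-f,r-1}$; if $k$ is even, a $G_{n,k,r}$ is any graph obtained from $K_f\vee T_{n-f,r-1}$ by adding one edge between two distinct non-adjacent vertices (so for even $k$ there may be two non-isomorphic graphs $G_{n,k,r}$). All graphs $G_{n,k,r}$ have the same number of edges, denoted $g_{n,k,r}$.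 Theorem. Let $n>16k^8r^{11}$. Every $P_{k,r}$-free graph $G$ on $n$ vertices satisfies $|E(G)|\le g_{n,k,r}$, and equality holds if and only if $G$ is isomorphic to a $G_{n,k,r}$. Moreover, every $G_{n,k,r}$ is itself $P_{k,r}$-free. -/

import Mathlib

/-- The clique-path `P_{k,r}`: a path `p_0, …, p_k` with `k` edges, where the `i`-th edge
`p_i p_{i+1}` (for `i < k`) is extended to an `r`-clique by `r - 2` new vertices `c_{i,j}`.
The vertex `p_i` is `Sum.inl i` and the vertex `c_{i,j}` is `Sum.inr (i, j)`. -/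
def cliquePath (k r : ℕ) : SimpleGraph (Fin (k + 1) ⊕ Fin k × Fin (r - 2)) where
  Adj
    | Sum.inl i, Sum.inl j => (SimpleGraph.pathGraph (k + 1)).Adj i j
    | Sum.inl i, Sum.inr c => i = c.1.castSucc ∨ i = c.1.succ
    | Sum.inr c, Sum.inl i => i = c.1.castSucc ∨ i = c.1.succ
    | Sum.inr c, Sum.inr d => c.1 = d.1 ∧ c.2 ≠ d.2
  symm := ⟨by
    rintro (i | c) (j | d) h
    · exact h.symm
    · exact h
    · exact h
    · exact ⟨h.1.symm, h.2.symm⟩⟩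
  loopless := ⟨by
    rintro (i | c) h
    · exact (SimpleGraph.pathGraph (k + 1)).loopless.irrefl i h
    · exact h.2 rfl⟩

/-- The join `G ∨ H`: the disjoint union of `G` and `H` together with all edges between them. -/
def graphJoin {V W : Type*} (G : SimpleGraph V) (H : SimpleGraph W) : SimpleGraph (V ⊕ W) :=
  G.sum H ⊔ completeBipartiteGraph V W

/-- The number `f = ⌊(k - 1) / 2⌋` of universal vertices (used for `k ≥ 1`). -/
def numUniversal (k : ℕ) : ℕ := (k - 1) / 2

/-- The graph `K_f ∨ T_{n-f,r-1}` with `f = ⌊(k - 1) / 2⌋`. -/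
def joinTuran (n k r : ℕ) : SimpleGraph (Fin (numUniversal k) ⊕ Fin (n - numUniversal k)) :=
  graphJoin (⊤ : SimpleGraph (Fin (numUniversal k)))
    (SimpleGraph.turanGraph (n - numUniversal k) (r - 1))

/-- `H` is a `G_{n,k,r}`: for odd `k` it is `K_f ∨ T_{n-f,r-1}`, and for even `k` it is
`K_f ∨ T_{n-f,r-1}` with one additional edge, placed on any two distinct non-adjacent vertices. -/
def IsGraphG (n k r : ℕ) (H : SimpleGraph (Fin (numUniversal k) ⊕ Fin (n - numUniversal k))) :
    Prop :=
  (Odd k ∧ H = joinTuran n k r) ∨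
    (Even k ∧ ∃ a b, a ≠ b ∧ ¬ (joinTuran n k r).Adj a b ∧
      H = joinTuran n k r ⊔ SimpleGraph.edge a b)

/-- The graph `G` is isomorphic to a `G_{n,k,r}`. -/
def IsoToGraphG {V : Type*} (n k r : ℕ) (G : SimpleGraph V) : Prop :=
  ∃ H, IsGraphG n k r H ∧ Nonempty (G ≃g H)

/-- The number of edges `g_{n,k,r}` of a `G_{n,k,r}`: that of `K_f ∨ T_{n-f,r-1}`, plus one if
`k` is even. -/
noncomputable def edgeCountG (n k r : ℕ) : ℕ :=
  (joinTuran n k r).edgeSet.ncard + if Even k then 1 else 0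

/-- All graphs `G_{n,k,r}` have `edgeCountG n k r` edges, so that this number is well defined. -/
theorem IsGraphG.ncard_edgeSet {n k r : ℕ}
    {H : SimpleGraph (Fin (numUniversal k) ⊕ Fin (n - numUniversal k))}
    (h : IsGraphG n k r H) : H.edgeSet.ncard = edgeCountG n k r := by
  rcases h with ⟨hk, rfl⟩ | ⟨hk, a, b, hab, hn, rfl⟩
  · simp [edgeCountG, Nat.not_even_iff_odd.2 hk]
  · rw [edgeCountG, if_pos hk, SimpleGraph.edgeSet_sup, SimpleGraph.edgeSet_edge_of_ne hab,
      Set.union_singleton, Set.ncard_insert_of_notMem]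
    simpa using hn

/-
Write `q = r - 1`. Deleting a vertex of degree smaller than the minimum degree of `K_f ∨ T_{n-f,q}`
raises the surplus of `G` over the extremal number. As the surplus is at most quadratic in the
number of remaining vertices, this stops while there are still many of them, so we may assume that
every vertex misses at most about `n / q` vertices. Then a clique-path can be prolonged greedily
along every edge with an end of degree somewhat above this minimum.

A bounded set `U` meets all `(q + 1)`-cliques: from many disjoint ones, an averaging argument
produces a subgraph of high minimum degree along whose edges a clique-path runs through a new
clique in every step. For `q = 2` only the triangles without an edge of a certain matching can be
met in this way, the links of the path being pairs of triangles with a common vertex. Outside `U`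
the graph has essentially at most Turán many edges, so having as many edges as `K_f ∨ T_{n-f,q}`
forces `U` to contain a set `W` of `f` vertices of large degree. A clique-path can be threaded
through `W`, gaining two cliques per vertex. Hence `G - W` contains no `(q + 1)`-clique if `k` is
odd, and no two `(q + 1)`-cliques with exactly one common vertex if `k` is even.

Turán's theorem settles the odd case. In the even case the Andrásfai–Erdős–Sós theorem gives a
colouring of `G - W` with `q` colours for which every vertex is adjacent to almost all vertices of
each other colour. A monochromatic edge extends to a `(q + 1)`-clique in many ways, so there is at
most one of them, and deleting it brings us back to Turán's theorem.
-/

namespace CliquePath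

open Finset SimpleGraph
open scoped Classical

section CliquesOfCliquePath

variable {k r : ℕ}

/-- The vertex set of the `i`-th clique of the clique-path `P_{k,r}`. -/
def cliqueOf (i : Fin k) : Set (Fin (k + 1) ⊕ Fin k × Fin (r - 2)) :=
  {x | Sum.elim (fun j => j = i.castSucc ∨ j = i.succ) (fun c => c.1 = i) x}

@[simp]
theorem inl_mem_cliqueOf {i : Fin k} {j : Fin (k + 1)} :
    Sum.inl j ∈ cliqueOf (r := r) i ↔ j = i.castSucc ∨ j = i.succ := Iff.rfl

@[simp]
theorem inr_mem_cliqueOf {i : Fin k} {c : Fin k × Fin (r - 2)} :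
    Sum.inr c ∈ cliqueOf i ↔ c.1 = i := Iff.rfl

theorem cliquePath_adj_iff {x y : Fin (k + 1) ⊕ Fin k × Fin (r - 2)} :
    (cliquePath k r).Adj x y ↔ x ≠ y ∧ ∃ i, x ∈ cliqueOf i ∧ y ∈ cliqueOf i := by
  rcases x with a | ⟨i, a⟩ <;> rcases y with b | ⟨j, b⟩
  · simp only [cliquePath, pathGraph_adj, ne_eq, Sum.inl.injEq, inl_mem_cliqueOf, Fin.ext_iff,
      Fin.val_castSucc, Fin.val_succ]
    refine ⟨fun h => ?_, by lia⟩
    rcases h with h | h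
    · exact ⟨by lia, ⟨a, by lia⟩, by simp [h]⟩
    · exact ⟨by lia, ⟨b, by lia⟩, by simp [h]⟩
  · simp [cliquePath]
  · simp [cliquePath]
  · simp only [cliquePath, ne_eq, Sum.inr.injEq, Prod.mk.injEq, inr_mem_cliqueOf, exists_eq_left']
    grind

theorem eq_of_mem_cliqueOf {i j : Fin k} {x y : Fin (k + 1) ⊕ Fin k × Fin (r - 2)} (hxy : x ≠ y)
    (hxi : x ∈ cliqueOf i) (hyi : y ∈ cliqueOf i) (hxj : x ∈ cliqueOf j) (hyj : y ∈ cliqueOf j) :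
    i = j := by
  rcases x with x | x <;> rcases y with y | y <;>
    simp_all only [inl_mem_cliqueOf, inr_mem_cliqueOf, Fin.ext_iff, Fin.val_castSucc, Fin.val_succ,
      ne_eq, Sum.inl.injEq]
  lia

theorem card_filter_mem_cliqueOf_le_two (x : Fin (k + 1) ⊕ Fin k × Fin (r - 2)) :
    #{i | x ∈ cliqueOf i} ≤ 2 := by
  rcases x with x | x
  · by_contra! hlt
    obtain ⟨a, ha, b, hb, c, hc, hab, hac, hbc⟩ := two_lt_card.1 hlt
    simp only [inl_mem_cliqueOf, mem_filter_univ, Fin.ext_iff, Fin.val_castSucc, Fin.val_succ,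
      ne_eq] at ha hb hc hab hac hbc
    lia
  · refine (card_le_one.2 fun a ha b hb => ?_).trans one_le_two
    exact (mem_filter.1 ha).2.symm.trans (mem_filter.1 hb).2

theorem card_filter_mem_cliqueOf (hr : 2 ≤ r) (i : Fin k) :
    #{x : Fin (k + 1) ⊕ Fin k × Fin (r - 2) | x ∈ cliqueOf i} = r := by
  have hpath : ({j : Fin (k + 1) | j = i.castSucc ∨ j = i.succ} : Finset _) =
      {i.castSucc, i.succ} := by
    ext; simp
  have hclique : ({c : Fin k × Fin (r - 2) | c.1 = i} : Finset _) = {i} ×ˢ univ := by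
    ext c; rw [mem_filter_univ, mem_product, mem_singleton, and_iff_left (mem_univ _)]
  simp only [card_filter, Fintype.sum_sum_type, inl_mem_cliqueOf, inr_mem_cliqueOf]
  rw [← card_filter, ← card_filter, hpath, hclique, card_pair Fin.castSucc_lt_succ.ne,
    card_product, card_singleton, card_univ, Fintype.card_fin]
  lia

theorem isNClique_map_cliqueOf {V : Type*} {G : SimpleGraph V} (hr : 2 ≤ r)
    (φ : Copy (cliquePath k r) G) (i : Fin k) :
    G.IsNClique r (({x | x ∈ cliqueOf i} : Finset _).map φ.toEmbedding) := by
  refine ⟨?_, by rw [card_map, card_filter_mem_cliqueOf hr]⟩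
  simp only [coe_map, coe_filter, mem_univ, true_and]
  rintro _ ⟨x, hx, rfl⟩ _ ⟨y, hy, rfl⟩ hne
  exact φ.toHom.map_adj (cliquePath_adj_iff.2 ⟨ne_of_apply_ne _ hne, i, hx, hy⟩)

theorem exists_isNClique_inter_eq_of_isContained {V : Type*} [DecidableEq V] {G : SimpleGraph V}
    (hr : 2 ≤ r) (h : cliquePath 2 r ⊑ G) :
    ∃ T₁ T₂ p, G.IsNClique r T₁ ∧ G.IsNClique r T₂ ∧ T₁ ∩ T₂ = {p} := by
  obtain ⟨φ⟩ := h
  let B (i : Fin 2) : Finset (Fin (2 + 1) ⊕ Fin 2 × Fin (r - 2)) := {x | x ∈ cliqueOf i}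
  have hinter : B 0 ∩ B 1 = {Sum.inl 1} := by
    ext (x | x)
    · simp only [B, mem_inter, mem_filter_univ, inl_mem_cliqueOf, mem_singleton, Sum.inl.injEq,
        Fin.ext_iff, Fin.val_castSucc, Fin.val_succ, Fin.val_zero, Fin.val_one]
      lia
    · simp only [B, mem_inter, mem_filter_univ, inr_mem_cliqueOf, mem_singleton, reduceCtorEq,
        iff_false, not_and]
      rintro h
      simp [h]
  exact ⟨_, _, φ (Sum.inl 1), isNClique_map_cliqueOf hr φ 0, isNClique_map_cliqueOf hr φ 1,
    by rw [← map_inter]; exact congrArg (map _) hinter⟩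

theorem not_free_of_isClique_image {V : Type*} {G : SimpleGraph V}
    {φ : Fin (k + 1) ⊕ Fin k × Fin (r - 2) → V} (hφ : Function.Injective φ)
    (h : ∀ i, G.IsClique (φ '' cliqueOf i)) : ¬ (cliquePath k r).Free G := by
  refine fun hfree => hfree ⟨⟨⟨φ, fun {x y} hxy => ?_⟩, hφ⟩⟩
  obtain ⟨hne, i, hx, hy⟩ := cliquePath_adj_iff.1 hxy
  exact h i (Set.mem_image_of_mem φ hx) (Set.mem_image_of_mem φ hy) (hφ.ne hne)

end CliquesOfCliquePath

section HasCliquePath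

variable {V : Type*} {G : SimpleGraph V} {q l k : ℕ} {A : Finset V} {p : V}

/-- `HasCliquePath G q l A p` means that `G` contains a clique-path `P_{l,q+1}` with vertex set `A`
whose last path vertex is `p`. Each new clique adds `q` vertices to the end of the previous one. -/
inductive HasCliquePath (G : SimpleGraph V) (q : ℕ) : ℕ → Finset V → V → Prop
  | single (p : V) : HasCliquePath G q 0 {p} p
  | snoc {l : ℕ} {A Q : Finset V} {p x : V} (path : HasCliquePath G q l A p)
      (disjoint : Disjoint A Q) (card_eq : #Q = q) (mem : x ∈ Q)
      (isClique : G.IsClique (insert p Q : Finset V)) : HasCliquePath G q (l + 1) (A ∪ Q) x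

theorem HasCliquePath.end_mem (h : HasCliquePath G q l A p) : p ∈ A := by
  cases h with
  | single => exact mem_singleton_self p
  | snoc _ _ _ hp => exact mem_union_right _ hp

theorem HasCliquePath.card_eq (h : HasCliquePath G q l A p) : #A = l * q + 1 := by
  induction h with
  | single => simp
  | snoc _ hd hQ _ _ ih => rw [card_union_of_disjoint hd, ih, hQ]; ring

theorem HasCliquePath.exists_of_le (h : HasCliquePath G q l A p) (hk : k ≤ l) :
    ∃ A p, HasCliquePath G q k A p := by
  induction h with
  | single p => exact ⟨{p}, p, Nat.le_zero.1 hk ▸ .single p⟩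
  | snoc h hd hQ hx hc ih =>
    rcases hk.eq_or_lt with rfl | hk
    · exact ⟨_, _, h.snoc hd hQ hx hc⟩
    · exact ih (Nat.lt_succ_iff.1 hk)

theorem HasCliquePath.of_isClique {T : Finset V} (hT : G.IsClique (T : Set V)) (hc : #T = q + 1)
    (hp : p ∈ T) (hq : 1 ≤ q) : HasCliquePath G q 1 T p := by
  obtain ⟨a, ha, hap⟩ := exists_mem_ne (by lia : 1 < #T) p
  have h := (HasCliquePath.single (G := G) (q := q) a).snoc (Q := T.erase a) (by simp)
    (by rw [card_erase_of_mem ha, hc, Nat.add_sub_cancel]) (mem_erase.2 ⟨hap.symm, hp⟩)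
    (by rwa [insert_erase ha])
  rwa [singleton_union, insert_erase ha] at h

theorem HasCliquePath.exists_seq (h : HasCliquePath G q l A p) :
    ∃ (P : ℕ → V) (Q : ℕ → Finset V), P l = p ∧ (∀ i ≤ l, P i ∈ Q i ∧ Q i ⊆ A) ∧
      (∀ i < l, #(Q (i + 1)) = q ∧ G.IsClique (insert (P i) (Q (i + 1)) : Finset V)) ∧
      ∀ j ≤ l, ∀ i < j, Disjoint (Q i) (Q j) := by
  induction h with
  | single p => exact ⟨fun _ => p, fun _ => {p}, by simp⟩
  | @snoc l A B p x _ hd hB hx hc ih =>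
    obtain ⟨P, Q, rfl, hPQ, hclique, hdisj⟩ := ih
    refine ⟨Function.update P (l + 1) x, Function.update Q (l + 1) B, by simp, ?_, ?_, ?_⟩
    · intro i hi
      rcases hi.eq_or_lt with rfl | hi
      · simp [hx]
      · rw [Function.update_of_ne hi.ne, Function.update_of_ne hi.ne]
        exact ⟨(hPQ i (by lia)).1, (hPQ i (by lia)).2.trans subset_union_left⟩
    · intro i hi
      rw [Function.update_of_ne hi.ne]
      rcases Nat.lt_succ_iff_lt_or_eq.1 hi with hi | rfl
      · rw [Function.update_of_ne (by lia)]
        exact hclique i hi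
      · rw [Function.update_self]
        exact ⟨hB, hc⟩
    · intro j hj i hij
      rw [Function.update_of_ne (by lia)]
      rcases hj.eq_or_lt with rfl | hj
      · rw [Function.update_self]
        exact hd.mono_left (hPQ i (by lia)).2
      · rw [Function.update_of_ne hj.ne]
        exact hdisj j (by lia) i hij

theorem HasCliquePath.not_free (h : HasCliquePath G q l A p) :
    ¬ (cliquePath l (q + 1)).Free G := by
  obtain ⟨P, Q, -, hPQ, hclique, hdisj⟩ := h.exists_seq
  have block_inj : ∀ {i j : ℕ} {a : V}, i ≤ l → j ≤ l → a ∈ Q i → a ∈ Q j → i = j := by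
    intro i j a hi hj hai haj
    by_contra hne
    rcases Ne.lt_or_gt hne with hij | hji
    · exact Finset.disjoint_left.1 (hdisj j hj i hij) hai haj
    · exact Finset.disjoint_left.1 (hdisj i hi j hji) haj hai
  have hcard (i : Fin l) : #((Q (i + 1)).erase (P (i + 1))) = q + 1 - 2 := by
    rw [card_erase_of_mem (hPQ _ i.2).1, (hclique i i.2).1]; lia
  let e (i : Fin l) := (equivFinOfCardEq (hcard i)).symm
  have he (i : Fin l) (j) : (e i j : V) ≠ P (i + 1) ∧ (e i j : V) ∈ Q (i + 1) :=
    mem_erase.1 (e i j).2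
  let φ : Fin (l + 1) ⊕ Fin l × Fin (q + 1 - 2) → V := Sum.elim (fun i => P i) fun c => e c.1 c.2
  have hφ : Function.Injective φ := by
    have inl_ne_inr (i : Fin (l + 1)) (c : Fin l × Fin (q + 1 - 2)) : P i ≠ e c.1 c.2 := by
      intro hic
      have hi : (i : ℕ) = c.1 + 1 :=
        block_inj (by lia) (by lia) (hPQ i (by lia)).1 (by rw [hic]; exact (he c.1 c.2).2)
      exact (he c.1 c.2).1 (by rw [← hic, hi])
    rintro (i | ⟨i, a⟩) (j | ⟨j, b⟩) hij
    · replace hij : P i = P j := hij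
      exact congrArg Sum.inl (Fin.ext (block_inj (by lia) (by lia) (hPQ i (by lia)).1
        (by rw [hij]; exact (hPQ j (by lia)).1)))
    · exact absurd hij (inl_ne_inr i (j, b))
    · exact absurd hij.symm (inl_ne_inr j (i, a))
    · replace hij : (e i a : V) = e j b := hij
      obtain rfl : i = j := Fin.ext (Nat.succ_injective
        (block_inj (by lia) (by lia) (he i a).2 (by rw [hij]; exact (he j b).2)))
      rw [(e i).injective (Subtype.ext hij)]
  refine not_free_of_isClique_image hφ fun i => (hclique i i.2).2.subset ?_
  rintro _ ⟨x | ⟨x, a⟩, hx, rfl⟩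
  · rcases hx with rfl | rfl
    · exact mem_insert_self _ _
    · exact mem_insert_of_mem (hPQ _ i.2).1
  · obtain rfl : x = i := hx
    exact mem_insert_of_mem (he x a).2

end HasCliquePath

section NearTuran

variable {V : Type*} [Fintype V] {G : SimpleGraph V} {q l m E : ℕ} {A K T T₁ T₂ Z : Finset V}
  {p u v w x y : V}

/-- The vertices that are not adjacent to `v`, among them `v` itself. -/
noncomputable def nonNbr (G : SimpleGraph V) (v : V) : Finset V := {x | ¬ G.Adj v x}

@[simp]
theorem mem_nonNbr : x ∈ nonNbr G v ↔ ¬ G.Adj v x := mem_filter_univ x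

/-- Every vertex of `G` has at least the minimum degree `n - m` of the Turán graph with `q` parts,
whose largest part has `m = ⌈n / q⌉` vertices; this value of `m` is encoded by two inequalities. -/
structure NearTuran (G : SimpleGraph V) (q m : ℕ) : Prop where
  two_le : 2 ≤ q
  card_nonNbr_le : ∀ v, #(nonNbr G v) ≤ m
  card_le : Fintype.card V ≤ q * m
  mul_le : q * m + 1 ≤ Fintype.card V + q

theorem NearTuran.two_mul_le (h : NearTuran G q m) : 2 * m ≤ Fintype.card V + 1 := by
  have h1 := h.mul_le
  obtain ⟨d, rfl⟩ := Nat.exists_eq_add_of_le h.two_le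
  rcases Nat.eq_zero_or_pos m with rfl | hm
  · lia
  · nlinarith [Nat.mul_le_mul_left d hm]

theorem exists_forall_adj_of_sum_lt (h : ∑ v ∈ K, #(nonNbr G v) + #Z < Fintype.card V) :
    ∃ x ∉ Z, ∀ v ∈ K, G.Adj v x := by
  have hlt : #(K.biUnion (nonNbr G) ∪ Z) < #(univ : Finset V) :=
    ((card_union_le _ _).trans (Nat.add_le_add_right card_biUnion_le _)).trans_lt h
  obtain ⟨x, -, hx⟩ := exists_mem_notMem_of_card_lt_card hlt
  simp only [mem_union, mem_biUnion, not_or, not_exists, not_and, mem_nonNbr] at hx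
  exact ⟨x, hx.2, fun v hv => not_not.1 (hx.1 v hv)⟩

theorem exists_adj_of_card_lt (h : #(nonNbr G v) + #Z < Fintype.card V) : ∃ x ∉ Z, G.Adj v x := by
  obtain ⟨x, hx, hvx⟩ := exists_forall_adj_of_sum_lt (K := {v}) (by rwa [sum_singleton])
  exact ⟨x, hx, hvx v (mem_singleton_self v)⟩

theorem sum_card_filter_not_adj_eq {V : Type*} {G : SimpleGraph V} (S T : Finset V) :
    ∑ x ∈ S, #{u ∈ T | ¬ G.Adj u x} = ∑ u ∈ T, #{x ∈ S | ¬ G.Adj u x} := by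
  simp only [card_filter]
  exact sum_comm

theorem card_filter_not_adj_le (S : Finset V) (v : V) :
    #{x ∈ S | ¬ G.Adj v x} ≤ #(nonNbr G v) :=
  card_le_card fun _ hx => mem_nonNbr.2 (mem_filter.1 hx).2

theorem NearTuran.sum_card_not_adj_le (h : NearTuran G q m) (S T : Finset V) :
    ∑ x ∈ S, #{u ∈ T | ¬ G.Adj u x} ≤ #T * m := by
  rw [sum_card_filter_not_adj_eq]
  exact sum_le_card_nsmul _ _ _ fun u _ => (card_filter_not_adj_le S u).trans (h.card_nonNbr_le u)

theorem NearTuran.exists_isClique (h : NearTuran G q m) (hw : #(nonNbr G w) + E ≤ m)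
    (hadj : G.Adj w y) (hZ : #Z + q ≤ E) :
    ∃ Q : Finset V, #Q + 1 = q ∧ Disjoint Q Z ∧ w ∉ Q ∧ y ∉ Q ∧
      G.IsClique (insert w (insert y Q) : Finset V) := by
  have hq := h.two_le
  suffices ∀ j, j + 1 ≤ q → ∃ Q : Finset V, #Q = j ∧ Disjoint Q Z ∧ w ∉ Q ∧ y ∉ Q ∧
      G.IsClique (insert w (insert y Q) : Finset V) by
    obtain ⟨Q, hQ, hQ'⟩ := this (q - 1) (by lia)
    exact ⟨Q, by lia, hQ'⟩
  intro j hj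
  induction j with
  | zero => exact ⟨∅, by simp [hadj]⟩
  | succ j ih =>
    obtain ⟨Q, hQ, hQZ, hwQ, hyQ, hclique⟩ := ih (by lia)
    have hsum : ∑ v ∈ insert w (insert y Q), #(nonNbr G v) + #Z < Fintype.card V := by
      have hyQsum : ∑ v ∈ insert y Q, #(nonNbr G v) ≤ (j + 1) * m := by
        rw [← hQ, ← card_insert_of_notMem hyQ]
        exact sum_le_card_nsmul _ _ m fun v _ => h.card_nonNbr_le v
      rw [sum_insert (by simp [hwQ, hadj.ne])]
      have := Nat.mul_le_mul_right m (show j + 2 ≤ q by lia)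
      nlinarith [h.mul_le]
    obtain ⟨x, hxZ, hx⟩ := exists_forall_adj_of_sum_lt hsum
    have hne : ∀ v ∈ insert w (insert y Q), v ≠ x := fun v hv => (hx v hv).ne
    simp only [mem_insert, forall_eq_or_imp] at hne
    refine ⟨insert x Q, ?_, disjoint_insert_left.2 ⟨hxZ, hQZ⟩, ?_, ?_, ?_⟩
    · rw [card_insert_of_notMem fun hxQ => hne.2.2 x hxQ rfl, hQ]
    · exact fun hmem => (mem_insert.1 hmem).elim hne.1 hwQ
    · exact fun hmem => (mem_insert.1 hmem).elim hne.2.1 hyQ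
    · rw [insert_comm y, insert_comm w, coe_insert, isClique_insert]
      exact ⟨hclique, fun b hb _ => (hx b hb).symm⟩

theorem NearTuran.exists_snoc (h : NearTuran G q m) (hA : HasCliquePath G q l A p)
    (hpx : G.Adj p x) (hxA : x ∉ A) (hlarge : #(nonNbr G p) + E ≤ m ∨ #(nonNbr G x) + E ≤ m)
    (hZ : #A + #Z + q ≤ E) :
    ∃ A', HasCliquePath G q (l + 1) A' x ∧ ∀ z ∈ Z, z ∈ A' → z = x ∨ z ∈ A := by
  obtain ⟨Q, hQ, hQZ, hxQ, hclique⟩ : ∃ Q : Finset V, #Q + 1 = q ∧ Disjoint Q (A ∪ Z) ∧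
      x ∉ Q ∧ G.IsClique (insert p (insert x Q) : Finset V) := by
    have hZ' : #(A ∪ Z) + q ≤ E := (Nat.add_le_add_right (card_union_le _ _) _).trans hZ
    rcases hlarge with hp | hx
    · obtain ⟨Q, hQ, hQZ, -, hxQ, hclique⟩ := h.exists_isClique hp hpx hZ'
      exact ⟨Q, hQ, hQZ, hxQ, hclique⟩
    · obtain ⟨Q, hQ, hQZ, hxQ, -, hclique⟩ := h.exists_isClique hx hpx.symm hZ'
      exact ⟨Q, hQ, hQZ, hxQ, by rwa [insert_comm]⟩
  rw [disjoint_union_right] at hQZ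
  refine ⟨A ∪ insert x Q, hA.snoc (disjoint_insert_right.2 ⟨hxA, hQZ.1.symm⟩) ?_
    (mem_insert_self _ _) hclique, ?_⟩
  · rw [card_insert_of_notMem hxQ, hQ]
  · intro z hz hzA
    have := Finset.disjoint_right.1 hQZ.2 hz
    grind

theorem NearTuran.exists_snoc_snoc (h : NearTuran G q m) (hA : HasCliquePath G q l A w)
    (hw : #(nonNbr G w) + E ≤ m) (hv : #(nonNbr G v) + E ≤ m) (hvA : v ∉ A)
    (hZ : #A + #Z + 2 * q ≤ E) :
    ∃ A', HasCliquePath G q (l + 2) A' v ∧ ∀ z ∈ Z, z ∈ A' → z = v ∨ z ∈ A := by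
  have hq := h.two_le
  have hwv : w ≠ v := fun h => hvA (h ▸ hA.end_mem)
  obtain ⟨y, hy, hadj⟩ := exists_forall_adj_of_sum_lt (G := G) (K := {w, v}) (Z := A ∪ Z) (by
    rw [sum_pair hwv]
    have := card_union_le A Z
    have := h.two_mul_le
    lia)
  have hyv : G.Adj v y := hadj v (by simp)
  obtain ⟨A₁, hA₁, hA₁Z⟩ := h.exists_snoc (Z := insert v Z) hA (hadj w (by simp)) (by grind)
    (Or.inl hw) (by have := card_insert_le v Z; lia)
  have hvA₁ : v ∉ A₁ := fun hmem => by
    rcases hA₁Z v (mem_insert_self v Z) hmem with hvy | hmem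
    exacts [hyv.ne hvy, hvA hmem]
  obtain ⟨A₂, hA₂, hA₂Z⟩ := h.exists_snoc (Z := Z) hA₁ hyv.symm hvA₁ (Or.inr hv)
    (by rw [hA₁.card_eq]; rw [hA.card_eq] at hZ; lia)
  exact ⟨A₂, hA₂, by grind⟩

theorem NearTuran.exists_thread (h : NearTuran G q m) (hA : HasCliquePath G q l A w)
    (hw : #(nonNbr G w) + E ≤ m) (hK : ∀ v ∈ K, #(nonNbr G v) + E ≤ m) (hAK : Disjoint A K)
    (hE : #A + #Z + (2 * q + 1) * #K ≤ E) :
    ∃ A', ∃ u ∈ insert w K, HasCliquePath G q (l + 2 * #K) A' u ∧ ∀ z ∈ Z, z ∈ A' → z ∈ A ∪ K := by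
  induction K using Finset.induction_on generalizing l A w with
  | empty => exact ⟨A, w, mem_singleton_self w, hA, by grind⟩
  | insert v K hvK ih =>
    rw [card_insert_of_notMem hvK] at hE
    rw [disjoint_insert_right] at hAK
    simp only [mem_insert, forall_eq_or_imp] at hK
    obtain ⟨A₁, hA₁, hA₁Z⟩ := h.exists_snoc_snoc (Z := Z ∪ K) hA hw hK.1 hAK.1
      (by have := card_union_le Z K; nlinarith)
    have hA₁K : Disjoint A₁ K := Finset.disjoint_right.2 fun z hz hzA =>
      (hA₁Z z (mem_union_right Z hz) hzA).elim (fun hzv => hvK (hzv ▸ hz))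
        (Finset.disjoint_right.1 hAK.2 hz)
    obtain ⟨A₂, u, hu, hA₂, hA₂Z⟩ := ih hA₁ hK.1 hK.2 hA₁K
      (by rw [hA₁.card_eq]; rw [hA.card_eq] at hE; nlinarith)
    refine ⟨A₂, u, mem_insert_of_mem hu, ?_, by grind⟩
    rw [card_insert_of_notMem hvK]
    convert hA₂ using 1
    ring

theorem NearTuran.exists_snoc_thread (h : NearTuran G q m) (hA : HasCliquePath G q l A y)
    (hK : ∀ v ∈ K, #(nonNbr G v) + E ≤ m) (hw : w ∈ K) (hyw : G.Adj y w) (hAK : Disjoint A K)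
    (hE : #A + #Z + (2 * q + 1) * #K ≤ E) :
    ∃ A', ∃ u ∈ K, HasCliquePath G q (l + 2 * #K - 1) A' u ∧ ∀ z ∈ Z, z ∈ A' → z ∈ A ∪ K := by
  have hcard := card_erase_add_one hw
  obtain ⟨A₁, hA₁, hA₁Z⟩ := h.exists_snoc (Z := Z ∪ K) (E := E) hA hyw
    (Finset.disjoint_right.1 hAK hw) (Or.inr (hK w hw))
    (by have := card_union_le Z K; nlinarith)
  have hA₁K : Disjoint A₁ (K.erase w) := Finset.disjoint_right.2 fun z hz hzA =>
    (hA₁Z z (mem_union_right Z (mem_of_mem_erase hz)) hzA).elim (ne_of_mem_erase hz)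
      (Finset.disjoint_right.1 hAK (mem_of_mem_erase hz))
  obtain ⟨A₂, u, hu, hA₂, hA₂Z⟩ := h.exists_thread (Z := Z) hA₁ (hK w hw)
    (fun v hv => hK v (mem_of_mem_erase hv)) hA₁K
    (by rw [hA₁.card_eq]; rw [hA.card_eq] at hE; nlinarith)
  refine ⟨A₂, u, by rwa [insert_erase hw] at hu, ?_, by grind⟩
  convert hA₂ using 1
  lia

theorem NearTuran.exists_add_two_mul_card (h : NearTuran G q m) (hA : HasCliquePath G q l A y)
    (hK : ∀ v ∈ K, #(nonNbr G v) + E ≤ m) (hw : w ∈ K) (hyw : G.Adj y w) (hAK : Disjoint A K)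
    (hE : #A + (2 * q + 1) * #K ≤ E) : ∃ A' p, HasCliquePath G q (l + 2 * #K) A' p := by
  have hKpos : 1 ≤ #K := card_pos.2 ⟨w, hw⟩
  obtain ⟨A₁, u, hu, hA₁, -⟩ := h.exists_snoc_thread (Z := ∅) hA hK hw hyw hAK (by simpa using hE)
  have hcard : #A₁ + q ≤ E := by
    obtain ⟨s, hs⟩ := Nat.exists_eq_add_of_le' hKpos
    rw [hA₁.card_eq, hs, show l + 2 * (s + 1) - 1 = l + 2 * s + 1 by lia]
    rw [hA.card_eq, hs] at hE
    nlinarith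
  have hlarge := hK u hu
  obtain ⟨x, hx, hux⟩ := exists_adj_of_card_lt (G := G) (v := u) (Z := A₁)
    (by have := h.two_mul_le; have := h.two_le; lia)
  obtain ⟨A₂, hA₂, -⟩ := h.exists_snoc (Z := ∅) hA₁ hux hx (Or.inl hlarge) (by simpa using hcard)
  exact ⟨A₂, x, by convert hA₂ using 1; lia⟩

theorem NearTuran.exists_hasCliquePath_two_mul_card (h : NearTuran G q m)
    (hK : ∀ v ∈ K, #(nonNbr G v) + E ≤ m) (hne : K.Nonempty)
    (hE : (2 * #K + 4) * (q + 1) ≤ E) : ∃ A p, HasCliquePath G q (2 * #K) A p := by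
  obtain ⟨w, hw⟩ := hne
  have hlarge := hK w hw
  obtain ⟨y, hyK, hwy⟩ := exists_adj_of_card_lt (G := G) (v := w) (Z := K)
    (by have := h.two_mul_le; nlinarith)
  obtain ⟨A, p, hA⟩ := h.exists_add_two_mul_card (.single y) hK hw hwy.symm
    (disjoint_singleton_left.2 hyK) (by rw [card_singleton]; nlinarith)
  exact ⟨A, p, by rwa [zero_add] at hA⟩

theorem NearTuran.exists_card_not_adj_le_one (h : NearTuran G q m) (hT : #T = q + 1)
    (hw : 6 * #(nonNbr G w) ≤ Fintype.card V) (hZ : 12 * #Z + 6 * q ≤ Fintype.card V) :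
    ∃ y ∉ Z, G.Adj w y ∧ #{u ∈ T | ¬ G.Adj u y} ≤ 1 := by
  have hcount : #{x | 2 ≤ #{u ∈ T | ¬ G.Adj u x}} * 2 ≤ (q + 1) * m := by
    rw [← hT]
    refine le_trans ?_ (h.sum_card_not_adj_le {x | 2 ≤ #{u ∈ T | ¬ G.Adj u x}} T)
    exact card_nsmul_le_sum _ _ 2 fun x hx => (mem_filter.1 hx).2
  have hcard := card_union_le Z {x | 2 ≤ #{u ∈ T | ¬ G.Adj u x}}
  obtain ⟨y, hy, hwy⟩ := exists_adj_of_card_lt (G := G) (v := w)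
    (Z := Z ∪ ({x | 2 ≤ #{u ∈ T | ¬ G.Adj u x}} : Finset V))
    (by have := h.two_mul_le; have := h.mul_le; lia)
  simp only [mem_union, mem_filter_univ, not_or, not_le] at hy
  exact ⟨y, hy.1, hwy, Nat.lt_succ_iff.1 hy.2⟩

theorem exists_forall_erase_adj_or {V : Type*} {G : SimpleGraph V} {T : Finset V} {y : V}
    (hT : #{u ∈ T | ¬ G.Adj u y} ≤ 1) (p : V) :
    (∃ u ∈ T, u ≠ p ∧ ∀ t ∈ T.erase u, G.Adj t y) ∨ ∀ t ∈ T.erase p, G.Adj t y := by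
  by_cases hex : ∃ u ∈ T, u ≠ p ∧ ¬ G.Adj u y
  · obtain ⟨u, hu, hup, huy⟩ := hex
    refine Or.inl ⟨u, hu, hup, fun t ht => ?_⟩
    by_contra hty
    exact ne_of_mem_erase ht (card_le_one.1 hT t (mem_filter.2 ⟨mem_of_mem_erase ht, hty⟩) u
      (mem_filter.2 ⟨hu, huy⟩))
  · push Not at hex
    exact Or.inr fun t ht => hex t (mem_of_mem_erase ht) (ne_of_mem_erase ht)

theorem isClique_insert_erase {V : Type*} {G : SimpleGraph V} {T : Finset V} {u y : V}
    (hT : G.IsClique (T : Set V)) (hy : ∀ t ∈ T.erase u, G.Adj t y) :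
    G.IsClique (insert y (T.erase u) : Finset V) := by
  rw [coe_insert, isClique_insert]
  exact ⟨hT.subset (by exact_mod_cast erase_subset _ _), fun b hb _ => (hy b hb).symm⟩

theorem card_insert_erase {α : Type*} {T : Finset α} {u y : α} (hu : u ∈ T) (hy : y ∉ T) :
    #(insert y (T.erase u)) = #T := by
  rw [card_insert_of_notMem fun h => hy (mem_of_mem_erase h), card_erase_add_one hu]

theorem NearTuran.exists_hasCliquePath_two_mul_card_add_one (h : NearTuran G q m)
    (hK : ∀ v ∈ K, #(nonNbr G v) + E ≤ m) (hKn : ∀ v ∈ K, 6 * #(nonNbr G v) ≤ Fintype.card V)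
    (hne : K.Nonempty) (hE : (2 * #K + 4) * (q + 1) ≤ E)
    (hn : 12 * ((2 * #K + 4) * (q + 1)) ≤ Fintype.card V)
    (hT : G.IsClique (T : Set V)) (hc : #T = q + 1) (hTK : Disjoint T K) :
    ∃ A p, HasCliquePath G q (2 * #K + 1) A p := by
  obtain ⟨w, hw⟩ := hne
  obtain ⟨y, hy, hwy, hTy⟩ := h.exists_card_not_adj_le_one (Z := T ∪ K) hc (hKn w hw)
    (by have := card_union_le T K; nlinarith)
  rw [mem_union, not_or] at hy
  obtain ⟨u, hu, huy⟩ : ∃ u ∈ T, ∀ t ∈ T.erase u, G.Adj t y := by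
    obtain ⟨p, hp⟩ := card_pos.1 (by lia : 0 < #T)
    rcases exists_forall_erase_adj_or hTy p with ⟨u, hu, -, huy⟩ | hpy
    exacts [⟨u, hu, huy⟩, ⟨p, hp, hpy⟩]
  have hc' := (card_insert_erase hu hy.1).trans hc
  obtain ⟨A, p, hA⟩ := h.exists_add_two_mul_card
    (.of_isClique (isClique_insert_erase hT huy) hc' (mem_insert_self _ _) (by grind [h.two_le])) hK
    hw hwy.symm (disjoint_insert_left.2 ⟨hy.2, hTK.mono_left (erase_subset _ _)⟩)
    (by rw [hc']; nlinarith)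
  exact ⟨A, p, by rwa [add_comm]⟩

theorem exists_hasCliquePath_two_of_forall_erase_adj {V : Type*} {G : SimpleGraph V} {q : ℕ}
    {T₁ T₂ : Finset V} {p u y : V} (hq : 1 ≤ q) (hT₁ : G.IsClique (T₁ : Set V)) (hc₁ : #T₁ = q + 1)
    (hT₂ : G.IsClique (T₂ : Set V)) (hc₂ : #T₂ = q + 1) (hp : T₁ ∩ T₂ = {p}) (hy₁ : y ∉ T₁)
    (hy₂ : y ∉ T₂) (hu : u ∈ T₂) (hup : u ≠ p) (huy : ∀ t ∈ T₂.erase u, G.Adj t y) :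
    ∃ A ⊆ insert y (T₁ ∪ T₂), HasCliquePath G q 2 A y := by
  have hp' : p ∈ T₁ ∩ T₂ := hp ▸ mem_singleton_self p
  rw [mem_inter] at hp'
  have hpQ : p ∈ insert y (T₂.erase u) := mem_insert_of_mem (mem_erase.2 ⟨hup.symm, hp'.2⟩)
  refine ⟨T₁ ∪ (insert y (T₂.erase u)).erase p, by grind, .snoc (.of_isClique hT₁ hc₁ hp'.1 hq)
    ?_ ?_ (mem_erase.2 ⟨fun hyp => hy₁ (hyp ▸ hp'.1), mem_insert_self _ _⟩) ?_⟩
  · rw [Finset.disjoint_left]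
    intro z hz hzQ
    have : z ∈ T₂ → z = p := fun hz₂ => mem_singleton.1 (hp ▸ mem_inter.2 ⟨hz, hz₂⟩)
    grind
  · rw [card_erase_of_mem hpQ, card_insert_erase hu hy₂, hc₂, Nat.add_sub_cancel]
  · rw [insert_erase hpQ]
    exact isClique_insert_erase hT₂ huy

theorem NearTuran.exists_hasCliquePath_of_forall_erase_adj (h : NearTuran G q m)
    (hK : ∀ v ∈ K, #(nonNbr G v) + E ≤ m) (hE : (2 * #K + 4) * (q + 1) ≤ E)
    (hT₁ : G.IsClique (T₁ : Set V)) (hc₁ : #T₁ = q + 1) (hT₂ : G.IsClique (T₂ : Set V))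
    (hc₂ : #T₂ = q + 1) (hp : T₁ ∩ T₂ = {p}) (hTK : Disjoint (T₁ ∪ T₂) K) (hw : w ∈ K)
    (hwy : G.Adj w y) (hy : y ∉ T₁ ∪ T₂ ∪ K) (hu : u ∈ T₂) (hup : u ≠ p)
    (huy : ∀ t ∈ T₂.erase u, G.Adj t y) : ∃ A p, HasCliquePath G q (2 * #K + 2) A p := by
  simp only [mem_union, not_or] at hy
  obtain ⟨A, hA, hAy⟩ := exists_hasCliquePath_two_of_forall_erase_adj (by grind [h.two_le]) hT₁ hc₁
    hT₂ hc₂ hp hy.1.1 hy.1.2 hu hup huy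
  obtain ⟨A', p', hA'⟩ := h.exists_add_two_mul_card hAy hK hw hwy.symm
    ((disjoint_insert_left.2 ⟨hy.2, hTK⟩).mono_left hA) (by rw [hAy.card_eq]; nlinarith)
  exact ⟨A', p', by rwa [add_comm]⟩

theorem NearTuran.exists_hasCliquePath_of_disjoint (h : NearTuran G q m)
    (hA : HasCliquePath G q l A u) (hT : G.IsClique (T : Set V)) (hc : #T = q + 1)
    (hAT : Disjoint A T) (hp : p ∈ T) (hy : y ∉ A ∪ T) (huy : G.Adj u y)
    (hu : #(nonNbr G u) + E ≤ m) (hE : #A + #T + q ≤ E) (hyT : ∀ t ∈ T.erase p, G.Adj t y) :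
    ∃ A p, HasCliquePath G q (l + 2) A p := by
  rw [mem_union, not_or] at hy
  obtain ⟨A₁, hA₁, hA₁T⟩ := h.exists_snoc (Z := T) hA huy hy.1 (Or.inl hu) hE
  have hc' : #(T.erase p) = q := by rw [card_erase_of_mem hp, hc, Nat.add_sub_cancel]
  obtain ⟨x, hx⟩ : (T.erase p).Nonempty := card_pos.1 (by grind [h.two_le])
  refine ⟨_, x, hA₁.snoc (Finset.disjoint_right.2 fun t ht htA => ?_) hc' hx
    (isClique_insert_erase hT hyT)⟩
  rcases hA₁T t (mem_of_mem_erase ht) htA with rfl | htA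
  exacts [hy.2 (mem_of_mem_erase ht), Finset.disjoint_left.1 hAT htA (mem_of_mem_erase ht)]

theorem NearTuran.exists_hasCliquePath_of_hasCliquePath (h : NearTuran G q m)
    (hK : ∀ v ∈ K, #(nonNbr G v) + E ≤ m) (hun : 6 * #(nonNbr G u) ≤ Fintype.card V)
    (hE : (2 * #K + 4) * (q + 1) ≤ E) (hn : 12 * ((2 * #K + 4) * (q + 1)) ≤ Fintype.card V)
    (hT₁ : G.IsClique (T₁ : Set V)) (hc₁ : #T₁ = q + 1) (hT₂ : G.IsClique (T₂ : Set V))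
    (hc₂ : #T₂ = q + 1) (hp : T₁ ∩ T₂ = {p}) (hTK : Disjoint (T₁ ∪ T₂) K)
    (hA : HasCliquePath G q (2 * #K) A u) (hu : u ∈ K) (hAT₂ : Disjoint A T₂) :
    ∃ A p, HasCliquePath G q (2 * #K + 2) A p := by
  have hAcard := hA.card_eq
  obtain ⟨x, hx, hux, hxT₂⟩ := h.exists_card_not_adj_le_one (Z := T₁ ∪ T₂ ∪ K ∪ A) hc₂ hun (by
    have := card_union_le (T₁ ∪ T₂ ∪ K) A
    have := card_union_le (T₁ ∪ T₂) K
    have := card_union_le T₁ T₂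
    nlinarith [h.two_le])
  rw [mem_union, not_or] at hx
  rcases exists_forall_erase_adj_or hxT₂ p with ⟨v, hv, hvp, hvx⟩ | hxp
  · exact h.exists_hasCliquePath_of_forall_erase_adj hK hE hT₁ hc₁ hT₂ hc₂ hp hTK hu hux hx.1 hv
      hvp hvx
  · have hp₂ : p ∈ T₂ := inter_subset_right (hp ▸ mem_singleton_self p)
    exact h.exists_hasCliquePath_of_disjoint hA hT₂ hc₂ hAT₂ hp₂ (by grind) hux (hK u hu)
      (by rw [hAcard, hc₂]; nlinarith) hxp

theorem disjoint_insert_erase_of_inter_eq {α : Type*} {T₁ T₂ : Finset α} {p y : α}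
    (hp : T₁ ∩ T₂ = {p}) (hy : y ∉ T₂) : Disjoint (insert y (T₁.erase p)) T₂ := by
  refine disjoint_insert_left.2 ⟨hy, Finset.disjoint_left.2 fun z hz hz₂ => ne_of_mem_erase hz ?_⟩
  exact mem_singleton.1 (hp ▸ mem_inter.2 ⟨mem_of_mem_erase hz, hz₂⟩)

theorem NearTuran.exists_hasCliquePath_two_mul_card_add_two (h : NearTuran G q m)
    (hK : ∀ v ∈ K, #(nonNbr G v) + E ≤ m) (hKn : ∀ v ∈ K, 6 * #(nonNbr G v) ≤ Fintype.card V)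
    (hne : K.Nonempty) (hE : (2 * #K + 4) * (q + 1) ≤ E)
    (hn : 12 * ((2 * #K + 4) * (q + 1)) ≤ Fintype.card V)
    (hT₁ : G.IsClique (T₁ : Set V)) (hc₁ : #T₁ = q + 1) (hT₂ : G.IsClique (T₂ : Set V))
    (hc₂ : #T₂ = q + 1) (hp : T₁ ∩ T₂ = {p}) (hTK : Disjoint (T₁ ∪ T₂) K) :
    ∃ A p, HasCliquePath G q (2 * #K + 2) A p := by
  obtain ⟨w, hw⟩ := hne
  have hp₁₂ : p ∈ T₁ ∧ p ∈ T₂ := mem_inter.1 (hp ▸ mem_singleton_self p)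
  obtain ⟨y, hy, hwy, hyT₁⟩ := h.exists_card_not_adj_le_one (Z := T₁ ∪ T₂ ∪ K) hc₁ (hKn w hw) (by
    have := card_union_le (T₁ ∪ T₂) K
    have := card_union_le T₁ T₂
    nlinarith)
  rcases exists_forall_erase_adj_or hyT₁ p with ⟨u, hu, hup, huy⟩ | hyp
  · exact h.exists_hasCliquePath_of_forall_erase_adj hK hE hT₂ hc₂ hT₁ hc₁ (inter_comm T₁ T₂ ▸ hp)
      (by rwa [union_comm]) hw hwy (by rwa [union_comm T₂]) hu hup huy
  simp only [mem_union, not_or] at hy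
  have hTK' := disjoint_union_left.1 hTK
  have hdisj := disjoint_insert_erase_of_inter_eq hp hy.1.2
  have hc₁' := (card_insert_erase hp₁₂.1 hy.1.1).trans hc₁
  obtain ⟨A, u, hu, hA, hAT₂⟩ := h.exists_snoc_thread (Z := T₂) (.of_isClique
    (isClique_insert_erase hT₁ hyp) hc₁' (mem_insert_self _ _) (by grind [h.two_le])) hK hw
    hwy.symm (disjoint_insert_left.2 ⟨hy.2, hTK'.1.mono_left (erase_subset _ _)⟩)
    (by rw [hc₁', hc₂]; nlinarith)
  have hAT₂' : Disjoint A T₂ := Finset.disjoint_right.2 fun t ht htA =>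
    (mem_union.1 (hAT₂ t ht htA)).elim (Finset.disjoint_right.1 hdisj ht)
      (Finset.disjoint_left.1 hTK'.2 ht)
  rw [Nat.add_sub_cancel_left] at hA
  exact h.exists_hasCliquePath_of_hasCliquePath hK (hKn u hu) hE hn hT₁ hc₁ hT₂ hc₂ hp hTK hA hu
    hAT₂'

end NearTuran

section Labels

variable {V ι : Type*} {G : SimpleGraph V}

theorem sum_card_adj_le_sum_erase_add (H : SimpleGraph V) {S : Finset V} {v : V} (hv : v ∈ S) :
    ∑ x ∈ S, #{y ∈ S | H.Adj x y} ≤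
      ∑ x ∈ S.erase v, #{y ∈ S.erase v | H.Adj x y} + 2 * #{y ∈ S | H.Adj v y} := by
  have hx : ∀ x ∈ S.erase v, #{y ∈ S | H.Adj x y} ≤
      #{y ∈ S.erase v | H.Adj x y} + if H.Adj v x then 1 else 0 := by
    intro x _
    split_ifs with hvx
    · rw [filter_erase, card_erase_of_mem (by simp [hv, hvx.symm])]
      lia
    · rw [filter_erase, erase_eq_of_notMem (by simp [hvx, H.adj_comm])]
      rfl
  have hsum := sum_le_sum hx
  rw [sum_add_distrib, ← card_filter] at hsum
  have herase : #{x ∈ S.erase v | H.Adj v x} ≤ #{y ∈ S | H.Adj v y} :=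
    card_le_card (filter_subset_filter _ (erase_subset _ _))
  rw [← add_sum_erase _ _ hv]
  lia

theorem exists_subset_forall_lt_card_adj (H : SimpleGraph V) (j : ℕ) (S : Finset V)
    (hS : 2 * j * #S < ∑ x ∈ S, #{y ∈ S | H.Adj x y}) :
    ∃ S' ⊆ S, S'.Nonempty ∧ ∀ v ∈ S', j < #{y ∈ S' | H.Adj v y} := by
  induction S using Finset.strongInduction with
  | H S ih =>
    by_cases hall : ∀ v ∈ S, j < #{y ∈ S | H.Adj v y}
    · exact ⟨S, subset_rfl, nonempty_of_ne_empty (by rintro rfl; simp at hS), hall⟩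
    · push Not at hall
      obtain ⟨v, hv, hvj⟩ := hall
      have hsum := sum_card_adj_le_sum_erase_add H hv
      obtain ⟨S', hS', h⟩ := ih (S.erase v) (erase_ssubset hv)
        (by rw [← card_erase_add_one hv] at hS; nlinarith)
      exact ⟨S', hS'.trans (erase_subset _ _), h⟩

/-- The graph whose edges belong to more than `j` of the graphs `R i` with `i ∈ I`: a clique-path
that follows its edges can use a different label `i` for each of them. -/
def popularGraph (R : ι → SimpleGraph V) (I : Finset ι) (j : ℕ) : SimpleGraph V where
  Adj x y := j < #{i ∈ I | (R i).Adj x y}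
  symm := ⟨fun x y h => by simpa only [SimpleGraph.adj_comm] using h⟩
  loopless := ⟨fun x h => by simp at h⟩

theorem sum_card_adj_le_popularGraph [Fintype V] (R : ι → SimpleGraph V) (I : Finset ι) (j : ℕ) :
    ∑ i ∈ I, ∑ x, #{y | (R i).Adj x y} ≤
      j * Fintype.card V ^ 2 + #I * ∑ x, #{y | (popularGraph R I j).Adj x y} := by
  have hxy : ∀ x y, #{i ∈ I | (R i).Adj x y} ≤
      j + #I * if (popularGraph R I j).Adj x y then 1 else 0 := by
    intro x y
    split_ifs with h
    · exact (card_filter_le _ _).trans (by lia)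
    · exact (not_lt.1 h).trans (by lia)
  calc ∑ i ∈ I, ∑ x, #{y | (R i).Adj x y} = ∑ x, ∑ y, #{i ∈ I | (R i).Adj x y} := by
        simp only [card_filter]
        rw [sum_comm]
        exact sum_congr rfl fun x _ => sum_comm
    _ ≤ ∑ x : V, ∑ y : V, (j + #I * if (popularGraph R I j).Adj x y then 1 else 0) :=
        sum_le_sum fun x _ => sum_le_sum fun y _ => hxy x y
    _ = j * Fintype.card V ^ 2 + #I * ∑ x, #{y | (popularGraph R I j).Adj x y} := by
        simp only [sum_add_distrib, ← mul_sum, sum_const, card_univ, smul_eq_mul, card_filter]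
        ring

variable {R : ι → SimpleGraph V} {I : Finset ι} {T : ι → Finset V} {S : Finset V} {q c j N : ℕ}

theorem exists_hasCliquePath_of_popularGraph (hT : (I : Set ι).PairwiseDisjoint T)
    (hST : ∀ x ∈ S, ∀ i ∈ I, x ∉ T i)
    (hstep : ∀ i ∈ I, ∀ x y l A, (R i).Adj x y → HasCliquePath G q l A x → Disjoint A (T i) →
      y ∉ A → ∃ A' ⊆ insert y (A ∪ T i), HasCliquePath G q (l + c) A' y)
    (hne : S.Nonempty) (hS : ∀ x ∈ S, j + 1 < #{y ∈ S | (popularGraph R I j).Adj x y}) :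
    ∃ A p, HasCliquePath G q (c * (j + 1)) A p := by
  suffices ∀ t ≤ j + 1, ∃ A, ∃ p ∈ S, ∃ X ⊆ S, ∃ J ⊆ I, HasCliquePath G q (c * t) A p ∧
      A ⊆ X ∪ J.biUnion T ∧ #X ≤ t + 1 ∧ #J ≤ t by
    obtain ⟨A, p, -, -, -, -, -, hA, -⟩ := this (j + 1) le_rfl
    exact ⟨A, p, hA⟩
  intro t ht
  induction t with
  | zero =>
    obtain ⟨s, hs⟩ := hne
    exact ⟨{s}, s, hs, {s}, by simpa using hs, ∅, by simp, .single s, by simp⟩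
  | succ t ih =>
    obtain ⟨A, p, hp, X, hX, J, hJ, hA, hAsub, hXcard, hJcard⟩ := ih (by lia)
    obtain ⟨y, hy, hyX⟩ := exists_mem_notMem_of_card_lt_card
      (hXcard.trans_lt (ht.trans_lt (hS p hp)))
    rw [mem_filter] at hy
    obtain ⟨i, hi, hiJ⟩ := exists_mem_notMem_of_card_lt_card
      (hJcard.trans_lt ((Nat.le_of_succ_le_succ ht).trans_lt hy.2))
    rw [mem_filter] at hi
    have hyA : y ∉ A := fun hyA => by
      rcases mem_union.1 (hAsub hyA) with hyX' | hyT
      · exact hyX hyX'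
      · obtain ⟨i', hi', hyi'⟩ := mem_biUnion.1 hyT
        exact hST y hy.1 i' (hJ hi') hyi'
    have hAT : Disjoint A (T i) := by
      refine .mono_left hAsub (disjoint_union_left.2 ⟨?_, (disjoint_biUnion_left _ _ _).2 ?_⟩)
      · exact Finset.disjoint_left.2 fun z hz => hST z (hX hz) i hi.1
      · exact fun i' hi' => hT (hJ hi') hi.1 fun h => hiJ (h ▸ hi')
    obtain ⟨A', hA'sub, hA'⟩ := hstep i hi.1 p y _ A hi.2 hA hAT hyA
    refine ⟨A', y, hy.1, insert y X, insert_subset hy.1 hX, insert i J, insert_subset hi.1 hJ, hA',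
      ?_, (card_insert_le _ _).trans (by lia), (card_insert_le _ _).trans (by lia)⟩
    rw [biUnion_insert]
    grind

theorem exists_hasCliquePath_of_labels [Fintype V] (hT : (I : Set ι).PairwiseDisjoint T)
    (hR : ∀ i ∈ I, ∀ x y, (R i).Adj x y → ∀ i' ∈ I, x ∉ T i')
    (hstep : ∀ i ∈ I, ∀ x y l A, (R i).Adj x y → HasCliquePath G q l A x → Disjoint A (T i) →
      y ∉ A → ∃ A' ⊆ insert y (A ∪ T i), HasCliquePath G q (l + c) A' y)
    (hN : ∀ i ∈ I, N ≤ ∑ x, #{y | (R i).Adj x y})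
    (hcard : j * Fintype.card V ^ 2 + 2 * (j + 1) * Fintype.card V * #I < #I * N) :
    ∃ A p, HasCliquePath G q (c * (j + 1)) A p := by
  have hpairs : 2 * (j + 1) * #(univ : Finset V) < ∑ x, #{y | (popularGraph R I j).Adj x y} := by
    have hpop := sum_card_adj_le_popularGraph R I j
    have hI := card_nsmul_le_sum I (fun i => ∑ x, #{y | (R i).Adj x y}) N hN
    rw [smul_eq_mul] at hI
    rw [card_univ]
    by_contra! hle
    nlinarith [Nat.mul_le_mul_left #I hle]
  obtain ⟨S, -, hne, hdeg⟩ := exists_subset_forall_lt_card_adj _ (j + 1) univ hpairs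
  refine exists_hasCliquePath_of_popularGraph hT (fun x hx => ?_) hstep hne hdeg
  obtain ⟨y, hy⟩ := card_pos.1 (Nat.zero_lt_of_lt (hdeg x hx))
  obtain ⟨i, hi⟩ := card_pos.1 (Nat.zero_lt_of_lt (mem_filter.1 hy).2)
  exact hR i (mem_filter.1 hi).1 x y (mem_filter.1 hi).2

theorem exists_pairwiseDisjoint_or_hitting {P : Finset V → Prop}
    (hP : ∀ s, P s → #s ≤ c ∧ s.Nonempty) (M : ℕ) :
    (∃ I : Finset (Finset V), #I = M ∧ (∀ s ∈ I, P s) ∧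
      (I : Set (Finset V)).PairwiseDisjoint id) ∨
    ∃ U : Finset V, #U ≤ M * c ∧ ∀ s, P s → ¬ Disjoint s U := by
  induction M with
  | zero => exact Or.inl ⟨∅, by simp⟩
  | succ M ih =>
    rcases ih with ⟨I, hI, hIP, hd⟩ | ⟨U, hU, h⟩
    · by_cases hs : ∃ s, P s ∧ Disjoint s (I.biUnion id)
      · obtain ⟨s, hs, hsd⟩ := hs
        rw [disjoint_biUnion_right] at hsd
        have hsI : s ∉ I := fun h =>
          (hP s hs).2.ne_empty (disjoint_self_iff_empty s |>.1 (hsd s h))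
        refine Or.inl ⟨insert s I, by rw [card_insert_of_notMem hsI, hI], ?_, ?_⟩
        · simpa only [mem_insert, forall_eq_or_imp] using ⟨hs, hIP⟩
        · rw [coe_insert]
          exact hd.insert fun t ht _ => hsd t ht
      · push Not at hs
        refine Or.inr ⟨I.biUnion id, ?_, hs⟩
        refine (card_biUnion_le_card_mul _ _ c fun s hs => (hP s (hIP s hs)).1).trans ?_
        rw [hI]
        exact Nat.mul_le_mul_right _ (by lia)
    · exact Or.inr ⟨U, hU.trans (Nat.mul_le_mul_right _ (by lia)), h⟩

end Labels

section Hitting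

variable {V : Type*} {G : SimpleGraph V} {q l k m : ℕ} {A K S T U : Finset V} {x y : V}

/-- The edges `xy` of `G` outside `U` such that at most two vertices of `K` fail to be common
neighbours of `x` and `y`: when `K` is a clique on `q + 1` vertices, a clique-path ending in `x` can
be continued through `K` to `y`. -/
def throughGraph (G : SimpleGraph V) (U K : Finset V) : SimpleGraph V where
  Adj x y := G.Adj x y ∧ #{u ∈ K | ¬ (G.Adj u x ∧ G.Adj u y)} ≤ 2 ∧ x ∉ U ∧ y ∉ U
  symm := ⟨fun x y h => by simpa only [G.adj_comm, and_comm] using h⟩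
  loopless := ⟨fun x h => h.1.ne rfl⟩

theorem HasCliquePath.exists_of_throughGraph_adj (hA : HasCliquePath G q l A x)
    (hK : G.IsClique (K : Set V)) (hc : #K = q + 1) (hq : 1 ≤ q)
    (hxy : (throughGraph G U K).Adj x y) (hAK : Disjoint A K) (hyA : y ∉ A) (hyK : y ∉ K) :
    ∃ A' ⊆ insert y (A ∪ K), HasCliquePath G q (l + 1) A' y := by
  obtain ⟨hxy, hK₂, -⟩ := hxy
  obtain ⟨D, hDsub, hDcard⟩ : ∃ D ⊆ {u ∈ K | G.Adj u x ∧ G.Adj u y}, #D = q - 1 := by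
    refine exists_subset_card_eq ?_
    have := card_filter_add_card_filter_not (s := K) fun u => G.Adj u x ∧ G.Adj u y
    lia
  have hD : ∀ z ∈ D, z ∈ K ∧ G.Adj z x ∧ G.Adj z y := fun z hz => mem_filter.1 (hDsub hz)
  have hyD : y ∉ D := fun h => hyK (hD y h).1
  refine ⟨A ∪ insert y D, by grind, hA.snoc ?_ ?_ (mem_insert_self _ _) ?_⟩
  · exact disjoint_insert_right.2 ⟨hyA, hAK.mono_right fun z hz => (hD z hz).1⟩
  · rw [card_insert_of_notMem hyD, hDcard]
    lia
  · rw [coe_insert, coe_insert, isClique_insert, isClique_insert]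
    refine ⟨⟨hK.subset fun z hz => (hD z hz).1, fun z hz _ => (hD z hz).2.2.symm⟩, ?_⟩
    rintro z (rfl | hz) -
    exacts [hxy, (hD z hz).2.1.symm]

variable [Fintype V]

theorem NearTuran.card_mul_sub_le (h : NearTuran G q m) {H : SimpleGraph V}
    (hH : ∀ x ∈ S, ∀ y ∈ T, G.Adj x y → H.Adj x y) :
    #S * (#T - m) ≤ ∑ x, #{y | H.Adj x y} := by
  refine le_trans ?_ (sum_le_sum_of_subset (subset_univ S))
  rw [← smul_eq_mul]
  refine card_nsmul_le_sum _ _ _ fun x hx => ?_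
  have hsplit := card_filter_add_card_filter_not (s := T) (G.Adj x)
  have hm := (card_filter_not_adj_le (G := G) T x).trans (h.card_nonNbr_le x)
  have hsub : #{y ∈ T | G.Adj x y} ≤ #{y | H.Adj x y} := card_le_card fun y hy => by
    rw [mem_filter] at hy
    exact mem_filter.2 ⟨mem_univ y, hH x hx y hy.1 hy.2⟩
  lia

theorem NearTuran.three_mul_card_le (h : NearTuran G q m) (S K : Finset V) :
    3 * #S ≤ #{x ∈ S | #{u ∈ K | ¬ G.Adj u x} ≤ 0} + #{x ∈ S | #{u ∈ K | ¬ G.Adj u x} ≤ 1} +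
      #{x ∈ S | #{u ∈ K | ¬ G.Adj u x} ≤ 2} + #K * m := by
  refine le_trans ?_ (Nat.add_le_add_left (h.sum_card_not_adj_le S K) _)
  have h3 : #S * 3 = ∑ x ∈ S, 3 := by rw [sum_const, smul_eq_mul]
  rw [mul_comm, h3, card_filter, card_filter, card_filter, ← sum_add_distrib, ← sum_add_distrib,
    ← sum_add_distrib]
  exact sum_le_sum fun x _ => by split_ifs <;> lia

theorem sq_le_of_three_mul_le {n a b c m s P : ℕ} (hq : 3 ≤ q) (hqm : q * m + 1 ≤ n + q)
    (hsum : 3 * (n - s) ≤ a + b + c + (q + 1) * m) (hab : a ≤ b) (hc : c ≤ n)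
    (hs : 400 * s ≤ n) (hn : 8000 * (q + 1) ≤ n) (hac : a * (c - m) ≤ P) (hb : b * (b - m) ≤ P) :
    n ^ 2 ≤ 20 * P := by
  have hm : 24000 * m ≤ 8001 * n := by
    have := Nat.mul_le_mul_right m hq
    lia
  have : 13336 * n + 10000 * (a + b + c) ≥ 30000 * (n - s) := by
    rw [add_mul, one_mul] at hsum
    lia
  rcases le_or_gt n (2 * b) with hnb | hnb
  · have := Nat.mul_le_mul (show n ≤ 2 * b from hnb) (show n ≤ 10 * (b - m) by lia)
    linarith
  · have := Nat.mul_le_mul (show 1580 * n ≤ 10000 * a by lia)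
      (show 3200 * n ≤ 10000 * (c - m) by lia)
    nlinarith

theorem NearTuran.sq_le_sum_throughGraph (h : NearTuran G q m) (hq : 3 ≤ q) (hK : #K = q + 1)
    (hU : 400 * #U ≤ Fintype.card V) (hn : 8000 * (q + 1) ≤ Fintype.card V) :
    Fintype.card V ^ 2 ≤ 20 * ∑ x, #{y | (throughGraph G U K).Adj x y} := by
  let S : ℕ → Finset V := fun i => {x ∈ Uᶜ | #{u ∈ K | ¬ G.Adj u x} ≤ i}
  have hthrough : ∀ i j, i + j ≤ 2 → ∀ x ∈ S i, ∀ y ∈ S j, G.Adj x y →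
      (throughGraph G U K).Adj x y := by
    intro i j hij x hx y hy hxy
    simp only [S, mem_filter, mem_compl] at hx hy
    refine ⟨hxy, ?_, hx.1, hy.1⟩
    simp only [not_and_or, filter_or]
    exact (card_union_le _ _).trans ((add_le_add hx.2 hy.2).trans hij)
  have hsum := h.three_mul_card_le Uᶜ K
  rw [card_compl, hK] at hsum
  exact sq_le_of_three_mul_le hq h.mul_le hsum
    (card_le_card (monotone_filter_right _ fun x _ hx => hx.trans zero_le_one)) (card_le_univ _) hU
    hn (h.card_mul_sub_le (hthrough 0 2 le_rfl)) (h.card_mul_sub_le (hthrough 1 1 le_rfl))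

theorem NearTuran.exists_hitting (h : NearTuran G q m) (hq : 3 ≤ q) (hk : 1 ≤ k)
    (hfree : (cliquePath k (q + 1)).Free G) (hn₁ : 8000 * k * (q + 1) ≤ Fintype.card V)
    (hn₂ : 60 * k ^ 2 ≤ Fintype.card V) :
    ∃ U : Finset V, #U ≤ 20 * k * (q + 1) ∧
      ∀ K : Finset V, G.IsClique (K : Set V) ∧ #K = q + 1 → ¬ Disjoint K U := by
  rcases exists_pairwiseDisjoint_or_hitting
    (P := fun K : Finset V => G.IsClique (K : Set V) ∧ #K = q + 1)
    (fun K hK => ⟨hK.2.le, card_pos.1 (by lia)⟩) (20 * k) with ⟨I, hI, hIK, hd⟩ | hU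
  · exfalso
    obtain ⟨d, rfl⟩ := Nat.exists_eq_add_of_le' hk
    have hUcard : #(I.biUnion id) = 20 * (d + 1) * (q + 1) := by
      rw [card_biUnion hd, ← hI, ← smul_eq_mul]
      exact sum_const_nat fun K hK => (hIK K hK).2
    obtain ⟨A, p, hA⟩ := exists_hasCliquePath_of_labels (G := G) (q := q) (c := 1) (j := d)
      (N := Fintype.card V ^ 2 / 20) (R := throughGraph G (I.biUnion id)) hd
      (fun K _ x y hxy K' hK' hx => hxy.2.2.1 (mem_biUnion.2 ⟨K', hK', hx⟩))
      (fun K hK x y l A hxy hA hAK hyA => hA.exists_of_throughGraph_adj (hIK K hK).1 (hIK K hK).2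
        (by lia) hxy hAK hyA fun hyK => hxy.2.2.2 (mem_biUnion.2 ⟨K, hK, hyK⟩))
      (fun K hK => Nat.div_le_of_le_mul (h.sq_le_sum_throughGraph hq (hIK K hK).2
        (by rw [hUcard]; lia) (by nlinarith)))
      (by
        rw [hI]
        have hdiv : Fintype.card V ^ 2 < 20 * (Fintype.card V ^ 2 / 20) + 20 := by lia
        have : 60 * (d + 1) ^ 2 * Fintype.card V ≤ Fintype.card V * Fintype.card V :=
          Nat.mul_le_mul_right _ hn₂
        have : 60 * (d + 1) ≤ Fintype.card V := by nlinarith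
        nlinarith)
    exact (by simpa using hA : HasCliquePath G q (d + 1) A p).not_free hfree
  · exact hU

end Hitting

section EdgeCount

variable {V : Type*} {q N : ℕ}

theorem ncard_edgeSet_eq_card_edgeFinset (H : SimpleGraph V) [Fintype H.edgeSet] :
    H.edgeSet.ncard = #H.edgeFinset := by
  rw [← coe_edgeFinset, Set.ncard_coe_finset]

theorem sum_card_adj_univ_eq [Fintype V] (H : SimpleGraph V) :
    ∑ x, #{y | H.Adj x y} = 2 * H.edgeSet.ncard := by
  simp only [ncard_edgeSet_eq_card_edgeFinset, ← sum_degrees_eq_twice_card_edges, degree,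
    neighborFinset_eq_filter]

theorem sum_card_adj_eq (H : SimpleGraph V) (S : Finset V) :
    ∑ x ∈ S, #{y ∈ S | H.Adj x y} = 2 * (H.induce (S : Set V)).edgeSet.ncard := by
  rw [← sum_card_adj_univ_eq, ← sum_coe_sort]
  refine sum_congr rfl fun x _ => ?_
  rw [← card_map (Function.Embedding.subtype (· ∈ (S : Set V)))]
  congr 1
  ext y
  simp [and_comm]

theorem card_adj_add_card_nonNbr [Fintype V] (G : SimpleGraph V) (x : V) :
    #{y | G.Adj x y} + #(nonNbr G x) = Fintype.card V := by
  rw [nonNbr, card_filter_add_card_filter_not, card_univ]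

theorem ncard_edgeSet_turanGraph_add (N q : ℕ) :
    (turanGraph (N + q) q).edgeSet.ncard =
      (turanGraph N q).edgeSet.ncard + N * (q - 1) + q.choose 2 := by
  simp only [ncard_edgeSet_eq_card_edgeFinset, card_edgeFinset_turanGraph_add]

theorem ncard_edgeSet_turanGraph_of_le (h : N ≤ q) :
    (turanGraph N q).edgeSet.ncard = N.choose 2 := by
  have htop : turanGraph N q = ⊤ := turanGraph_eq_top.2 (Or.inr h)
  rw [htop, ncard_edgeSet_eq_card_edgeFinset, card_edgeFinset_top_eq_card_choose_two,
    Fintype.card_fin]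

theorem ncard_edgeSet_turanGraph_succ (hq : 1 ≤ q) (N : ℕ) :
    (turanGraph (N + 1) q).edgeSet.ncard + N / q = (turanGraph N q).edgeSet.ncard + N := by
  induction N using Nat.strong_induction_on with
  | h N ih =>
    rcases lt_or_ge N q with hlt | hle
    · rw [ncard_edgeSet_turanGraph_of_le hlt, ncard_edgeSet_turanGraph_of_le hlt.le,
        Nat.div_eq_of_lt hlt, Nat.choose_succ_succ' N 1, Nat.choose_one_right]
      lia
    · obtain ⟨M, rfl⟩ := Nat.exists_eq_add_of_le' hle
      have h := ih M (by lia)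
      rw [Nat.add_div_right M hq, Nat.add_right_comm, ncard_edgeSet_turanGraph_add,
        ncard_edgeSet_turanGraph_add]
      obtain ⟨c, rfl⟩ := Nat.exists_eq_add_of_le' hq
      rw [Nat.add_sub_cancel, add_mul]
      lia

theorem mul_ncard_edgeSet_turanGraph_le (N q : ℕ) :
    q * (2 * (turanGraph N q).edgeSet.ncard) ≤ (q - 1) * N ^ 2 := by
  rw [ncard_edgeSet_eq_card_edgeFinset, ← mul_assoc, mul_comm q]
  exact mul_card_edgeFinset_turanGraph_le

theorem le_mul_ncard_edgeSet_turanGraph (hq : 1 ≤ q) (N : ℕ) :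
    (q - 1) * N ^ 2 ≤ q * (2 * (turanGraph N q).edgeSet.ncard) + q ^ 2 := by
  induction N using Nat.strong_induction_on with
  | h N ih =>
    rcases lt_or_ge N q with hlt | hle
    · rw [ncard_edgeSet_turanGraph_of_le hlt.le, Nat.choose_two_right,
        Nat.mul_div_cancel' (Nat.even_mul_pred_self N).two_dvd]
      rcases N with - | N
      · simp
      · obtain ⟨c, rfl⟩ := Nat.exists_eq_add_of_le' hq
        simp only [Nat.add_sub_cancel]
        nlinarith
    · obtain ⟨M, rfl⟩ := Nat.exists_eq_add_of_le' hle
      have h := ih M (by lia)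
      have hchoose : 2 * q.choose 2 = q * (q - 1) := by
        rw [Nat.choose_two_right, Nat.mul_div_cancel' (Nat.even_mul_pred_self q).two_dvd]
      calc (q - 1) * (M + q) ^ 2
          = (q - 1) * M ^ 2 + q * (2 * (M * (q - 1)) + q * (q - 1)) := by ring
        _ ≤ q * (2 * (turanGraph M q).edgeSet.ncard) + q ^ 2 +
              q * (2 * (M * (q - 1)) + 2 * q.choose 2) := by rw [hchoose]; gcongr
        _ = _ := by rw [ncard_edgeSet_turanGraph_add]; ring

variable [Fintype V] {G H F : SimpleGraph V} {U : Finset V}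

theorem exists_isTuranMaximal_ncard_edgeSet_eq (hq : 0 < q) : ∃ J : SimpleGraph V,
    J.IsTuranMaximal q ∧ J.edgeSet.ncard = (turanGraph (Fintype.card V) q).edgeSet.ncard := by
  obtain ⟨J, _, hJ⟩ := exists_isTuranMaximal (V := V) hq
  obtain ⟨e⟩ := hJ.nonempty_iso_turanGraph
  refine ⟨J, by convert hJ, ?_⟩
  rw [ncard_edgeSet_eq_card_edgeFinset, ncard_edgeSet_eq_card_edgeFinset]
  exact e.card_edgeFinset_eq

theorem ncard_edgeSet_le_of_cliqueFree (hG : G.CliqueFree (q + 1)) (hq : 0 < q) :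
    G.edgeSet.ncard ≤ (turanGraph (Fintype.card V) q).edgeSet.ncard := by
  obtain ⟨J, hJ, hJcard⟩ := exists_isTuranMaximal_ncard_edgeSet_eq (V := V) hq
  rw [← hJcard, ncard_edgeSet_eq_card_edgeFinset, ncard_edgeSet_eq_card_edgeFinset]
  exact hJ.2 hG

theorem nonempty_iso_turanGraph_of_cliqueFree (hG : G.CliqueFree (q + 1)) (hq : 0 < q)
    (he : G.edgeSet.ncard = (turanGraph (Fintype.card V) q).edgeSet.ncard) :
    Nonempty (G ≃g turanGraph (Fintype.card V) q) := by
  refine IsTuranMaximal.nonempty_iso_turanGraph ⟨hG, fun H _ hH => ?_⟩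
  rw [← ncard_edgeSet_eq_card_edgeFinset, ← ncard_edgeSet_eq_card_edgeFinset, he]
  exact ncard_edgeSet_le_of_cliqueFree hH hq

theorem mul_sum_card_adj_le {V : Type*} {H : SimpleGraph V} {S : Finset V}
    (hS : ∀ K ⊆ S, ¬ H.IsNClique (q + 1) K) (hq : 0 < q) :
    q * ∑ x ∈ S, #{y ∈ S | H.Adj x y} ≤ (q - 1) * #S ^ 2 := by
  have hfree : (H.induce (S : Set V)).CliqueFree (q + 1) := by
    rw [cliqueFree_induce_iff]
    exact fun K hK => hS K (by exact_mod_cast hK)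
  have hcard : Fintype.card (S : Set V) = #S := Fintype.card_coe S
  have hle := ncard_edgeSet_le_of_cliqueFree hfree hq
  rw [hcard] at hle
  rw [sum_card_adj_eq]
  exact (by gcongr : _ ≤ _).trans (mul_ncard_edgeSet_turanGraph_le #S q)

theorem two_mul_ncard_edgeSet_le (G : SimpleGraph V) (U : Finset V) :
    2 * G.edgeSet.ncard ≤
      ∑ x ∈ Uᶜ, #{y ∈ Uᶜ | G.Adj x y} + 2 * ∑ w ∈ U, #{y | G.Adj w y} := by
  have hsplit : ∑ x ∈ Uᶜ, #{y | G.Adj x y} =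
      ∑ x ∈ Uᶜ, #{y ∈ U | G.Adj x y} + ∑ x ∈ Uᶜ, #{y ∈ Uᶜ | G.Adj x y} := by
    rw [← sum_add_distrib]
    refine sum_congr rfl fun x _ => ?_
    rw [← card_union_of_disjoint (disjoint_filter_filter disjoint_compl_right), ← filter_union,
      union_compl]
  have hcross : ∑ x ∈ Uᶜ, #{y ∈ U | G.Adj x y} ≤ ∑ w ∈ U, #{y | G.Adj w y} := by
    calc ∑ x ∈ Uᶜ, #{y ∈ U | G.Adj x y}
        = ∑ w ∈ U, #{x ∈ Uᶜ | G.Adj x w} := by simp only [card_filter]; exact sum_comm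
      _ ≤ ∑ w ∈ U, #{y | G.Adj w y} := sum_le_sum fun w _ => by
        simp only [G.adj_comm _ w]
        exact card_le_card (filter_subset_filter _ (subset_univ _))
  rw [← sum_card_adj_univ_eq, ← sum_add_sum_compl U, hsplit]
  lia

theorem mul_ncard_edgeSet_le (hq : 0 < q) (hHF : G ≤ H ⊔ F)
    (hU : ∀ K ⊆ Uᶜ, ¬ H.IsNClique (q + 1) K) :
    q * (2 * G.edgeSet.ncard) ≤ (q - 1) * (Fintype.card V - #U) ^ 2 +
      q * (2 * ∑ w ∈ U, #{y | G.Adj w y}) + q * ∑ x ∈ Uᶜ, #{y ∈ Uᶜ | F.Adj x y} := by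
  have hcover : ∑ x ∈ Uᶜ, #{y ∈ Uᶜ | G.Adj x y} ≤
      ∑ x ∈ Uᶜ, #{y ∈ Uᶜ | H.Adj x y} + ∑ x ∈ Uᶜ, #{y ∈ Uᶜ | F.Adj x y} := by
    rw [← sum_add_distrib]
    refine sum_le_sum fun x _ => le_trans (card_le_card ?_) (card_union_le _ _)
    rw [← filter_or]
    exact monotone_filter_right _ fun y _ hxy => hHF hxy
  calc q * (2 * G.edgeSet.ncard)
      ≤ q * (∑ x ∈ Uᶜ, #{y ∈ Uᶜ | H.Adj x y} + ∑ x ∈ Uᶜ, #{y ∈ Uᶜ | F.Adj x y} +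
          2 * ∑ w ∈ U, #{y | G.Adj w y}) := by
        grw [two_mul_ncard_edgeSet_le G U, hcover]
    _ = q * ∑ x ∈ Uᶜ, #{y ∈ Uᶜ | H.Adj x y} + q * (2 * ∑ w ∈ U, #{y | G.Adj w y}) +
          q * ∑ x ∈ Uᶜ, #{y ∈ Uᶜ | F.Adj x y} := by ring
    _ ≤ _ := by
        grw [mul_sum_card_adj_le hU hq, card_compl]

end EdgeCount

section LargeVertices

variable {V : Type*} [Fintype V] {G H F : SimpleGraph V} {q k m f E : ℕ} {U W : Finset V}

theorem NearTuran.mul_sum_card_adj_add_le (h : NearTuran G q m) (U : Finset V) (E : ℕ) :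
    q * ∑ w ∈ U, #{y | G.Adj w y} + q * ∑ w ∈ U with #(nonNbr G w) + E ≤ m, #(nonNbr G w) +
      (#U - #{w ∈ U | #(nonNbr G w) + E ≤ m}) * Fintype.card V ≤
        #U * (q * (Fintype.card V + E)) := by
  have hsmall : #U - #{w ∈ U | #(nonNbr G w) + E ≤ m} = #{w ∈ U | ¬ #(nonNbr G w) + E ≤ m} :=
    Nat.sub_eq_of_eq_add' (card_filter_add_card_filter_not _).symm
  rw [hsmall, card_eq_sum_ones, sum_mul, mul_sum, mul_sum, one_mul, add_assoc, ← sum_ite,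
    ← sum_add_distrib, ← smul_eq_mul #U]
  refine sum_le_card_nsmul _ _ _ fun w _ => ?_
  have hdeg := congrArg (q * ·) (card_adj_add_card_nonNbr G w)
  simp only [mul_add] at hdeg ⊢
  split_ifs with hw
  · lia
  · have hm := Nat.mul_le_mul_left q (not_le.1 hw).le
    rw [mul_add] at hm
    have := h.card_le
    lia

/-- A comparison with the edge count of `K_f ∨ T_{n-f,q}` by which a set `U` meeting all
`(q + 1)`-cliques of `H` contains `f` vertices of large degree if `F` is sparse off `U`. -/
theorem NearTuran.card_mul_add_sum_le (h : NearTuran G q m) (hHF : G ≤ H ⊔ F)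
    (hU : ∀ K ⊆ Uᶜ, ¬ H.IsNClique (q + 1) K) (hf : f ≤ Fintype.card V)
    (he : f * (Fintype.card V - f) + (turanGraph (Fintype.card V - f) q).edgeSet.ncard ≤
      G.edgeSet.ncard) (E : ℕ) :
    2 * f * Fintype.card V + 2 * q * ∑ w ∈ U with #(nonNbr G w) + E ≤ m, #(nonNbr G w) ≤
      2 * #{w ∈ U | #(nonNbr G w) + E ≤ m} * Fintype.card V +
        q * (#U ^ 2 + 2 * #U * E + 2 * f ^ 2 + q + ∑ x ∈ Uᶜ, #{y ∈ Uᶜ | F.Adj x y}) := by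
  have hq : 1 ≤ q := one_le_two.trans h.two_le
  have hupper := mul_ncard_edgeSet_le hq hHF hU
  have hturan := le_mul_ncard_edgeSet_turanGraph hq (Fintype.card V - f)
  have hdeg := h.mul_sum_card_adj_add_le U E
  have hY : #{w ∈ U | #(nonNbr G w) + E ≤ m} ≤ #U := card_filter_le _ _
  have hUV : #U ≤ Fintype.card V := card_le_univ U
  have hlower := Nat.mul_le_mul_left q (Nat.mul_le_mul_left 2 he)
  generalize ∑ w ∈ U, #{y | G.Adj w y} = D at *
  generalize ∑ x ∈ Uᶜ, #{y ∈ Uᶜ | F.Adj x y} = φ at *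
  generalize ∑ w ∈ U with #(nonNbr G w) + E ≤ m, #(nonNbr G w) = y at *
  generalize #{w ∈ U | #(nonNbr G w) + E ≤ m} = a at *
  zify [hY, hUV, hf, hq] at hupper hturan hdeg hlower ⊢
  have hf_sq : (0 : ℤ) ≤ (q - 1) * f ^ 2 :=
    mul_nonneg (sub_nonneg.2 (by exact_mod_cast hq)) (sq_nonneg _)
  linarith [sq_nonneg (#U : ℤ)]

theorem NearTuran.card_le_of_free (h : NearTuran G q m) (hkf : k ≤ 2 * f + 2)
    (hE : (2 * f + 6) * (q + 1) ≤ E) (hfree : (cliquePath k (q + 1)).Free G)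
    (hW : ∀ w ∈ W, #(nonNbr G w) + E ≤ m) : #W ≤ f := by
  by_contra! hlt
  obtain ⟨W', hW', hc⟩ := exists_subset_card_eq (show f + 1 ≤ #W from hlt)
  obtain ⟨A, p, hA⟩ := h.exists_hasCliquePath_two_mul_card (fun w hw => hW w (hW' hw))
    (card_pos.1 (by lia)) (by rw [hc]; exact hE)
  obtain ⟨A', p', hA'⟩ := hA.exists_of_le (k := k) (by lia)
  exact hA'.not_free hfree

theorem two_mul_le_of_card_mul_add_sum_le {n a s D : ℕ} (hq : 0 < q)
    (h : 2 * f * n + 2 * q * s ≤ 2 * a * n + q * D) (ha : a ≤ f) (hD : q * D < 2 * n) :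
    a = f ∧ 2 * s ≤ D := by
  obtain rfl : a = f := by
    by_contra hne
    have := Nat.mul_le_mul_right (2 * n) (show a + 1 ≤ f by lia)
    have := Nat.zero_le (2 * q * s)
    linarith
  exact ⟨rfl, Nat.le_of_mul_le_mul_left (by linarith : q * (2 * s) ≤ q * D) hq⟩

theorem mul_sq_add_le_of_three_le {n s : ℕ} (hq : 3 ≤ q) (hk : 3 ≤ k) (hf : 2 * f ≤ k)
    (hn : 9 * k ^ 4 * (q + 1) ^ 5 ≤ n) (hs : s ≤ 20 * k * (q + 1)) :
    q * (s ^ 2 + 2 * s * ((2 * f + 6) * (q + 1)) + 2 * f ^ 2 + q) ≤ n := by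
  set r := q + 1
  have hr : 4 ≤ r := by lia
  have hkr : q ≤ (k * r) ^ 2 := by
    calc q ≤ 1 * r := by lia
      _ ≤ k * r := by gcongr; lia
      _ ≤ (k * r) ^ 2 := Nat.le_self_pow two_ne_zero _
  calc q * (s ^ 2 + 2 * s * ((2 * f + 6) * r) + 2 * f ^ 2 + q)
      ≤ r * ((20 * k * r) ^ 2 + 2 * (20 * k * r) * (3 * k * r) + 2 * (k * r) ^ 2 +
          (k * r) ^ 2) := by
        gcongr
        · lia
        · lia
        · calc f ≤ k * 1 := by lia
            _ ≤ k * r := by gcongr; lia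
    _ = 523 * (k * r) ^ 2 * r := by ring
    _ ≤ 9 * (3 * 4) ^ 2 * (k * r) ^ 2 * r := by gcongr; norm_num
    _ ≤ 9 * (k * r) ^ 2 * (k * r) ^ 2 * r := by gcongr
    _ = 9 * k ^ 4 * r ^ 5 := by ring
    _ ≤ n := hn

theorem NearTuran.exists_large_degree_of_three_le (h : NearTuran G q m) (hq : 3 ≤ q) (hk : 3 ≤ k)
    (hf₁ : 2 * f + 1 ≤ k) (hf₂ : k ≤ 2 * f + 2)
    (hn : 9 * k ^ 4 * (q + 1) ^ 5 ≤ Fintype.card V) (hfree : (cliquePath k (q + 1)).Free G)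
    (he : f * (Fintype.card V - f) + (turanGraph (Fintype.card V - f) q).edgeSet.ncard ≤
      G.edgeSet.ncard) :
    ∃ W : Finset V, #W = f ∧ ∀ w ∈ W, #(nonNbr G w) + (2 * f + 6) * (q + 1) ≤ m ∧
      6 * #(nonNbr G w) ≤ Fintype.card V := by
  have hn₁ : 8000 * k * (q + 1) ≤ Fintype.card V := by
    calc 8000 * k * (q + 1) ≤ 9 * 3 ^ 3 * (3 + 1) ^ 4 * k * (q + 1) := by gcongr; norm_num
      _ ≤ 9 * k ^ 3 * (q + 1) ^ 4 * k * (q + 1) := by gcongr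
      _ = 9 * k ^ 4 * (q + 1) ^ 5 := by ring
      _ ≤ Fintype.card V := hn
  have hn₂ : 60 * k ^ 2 ≤ Fintype.card V := by
    calc 60 * k ^ 2 ≤ 9 * 3 ^ 2 * (0 + 1) ^ 5 * k ^ 2 := by gcongr; norm_num
      _ ≤ 9 * k ^ 2 * (q + 1) ^ 5 * k ^ 2 := by gcongr; lia
      _ = 9 * k ^ 4 * (q + 1) ^ 5 := by ring
      _ ≤ Fintype.card V := hn
  obtain ⟨U, hUc, hU⟩ := h.exists_hitting hq (by lia) hfree hn₁ hn₂
  have hD := mul_sq_add_le_of_three_le (f := f) hq hk (by lia) hn hUc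
  have hsum := h.card_mul_add_sum_le (H := G) (F := ⊥) (by simp)
    (fun K hKU hK => hU K ⟨hK.isClique, hK.card_eq⟩ (subset_compl_iff_disjoint_right.1 hKU))
    (by nlinarith only [hf₁, hn₂]) he ((2 * f + 6) * (q + 1))
  simp only [bot_adj, filter_false, card_empty, sum_const_zero, add_zero] at hsum
  set W := {w ∈ U | #(nonNbr G w) + (2 * f + 6) * (q + 1) ≤ m}
  have hWlarge : ∀ w ∈ W, #(nonNbr G w) + (2 * f + 6) * (q + 1) ≤ m := fun w hw =>
    (mem_filter.1 hw).2
  obtain ⟨hW, hWsum⟩ := two_mul_le_of_card_mul_add_sum_le (by lia) hsum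
    (h.card_le_of_free hf₂ le_rfl hfree hWlarge) (by nlinarith only [hD, hn₂, hk])
  refine ⟨W, hW, fun w hw => ⟨hWlarge w hw, ?_⟩⟩
  have hw_le := single_le_sum (f := fun w => #(nonNbr G w)) (fun _ _ => Nat.zero_le _) hw
  calc 6 * #(nonNbr G w) ≤ 3 * (2 * ∑ w ∈ W, #(nonNbr G w)) := by linarith
    _ ≤ _ := (Nat.mul_le_mul hq hWsum).trans hD

end LargeVertices

section Cherry

variable {V : Type*} {G : SimpleGraph V} {l : ℕ} {A S U : Finset V} {x y : V}

/-- Two vertices `x`, `y` outside `U` are adjacent if triangles on `v, a` and `v, a'`, where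
`s = {v, a, a'}`, connect `x` to `y` through `v`. -/
def cherryGraph (G : SimpleGraph V) (U s : Finset V) : SimpleGraph V where
  Adj x y := x ≠ y ∧ x ∉ U ∧ y ∉ U ∧ ∃ v a a', a ≠ a' ∧ s = {v, a, a'} ∧
    G.IsNClique 3 {x, v, a} ∧ G.IsNClique 3 {v, a', y}
  symm := ⟨fun x y ⟨hne, hx, hy, v, a, a', ha, hs, h, h'⟩ => ⟨hne.symm, hy, hx, v, a', a, ha.symm,
    by rw [hs, pair_comm], by rwa [insert_comm, pair_comm], by rwa [pair_comm, insert_comm]⟩⟩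
  loopless := ⟨fun x h => h.1 rfl⟩

theorem HasCliquePath.exists_of_cherryGraph_adj (hA : HasCliquePath G 2 l A x)
    (hxy : (cherryGraph G U S).Adj x y) (hAS : Disjoint A S) (hyA : y ∉ A) (hyS : y ∉ S) :
    ∃ A' ⊆ insert y (A ∪ S), HasCliquePath G 2 (l + 2) A' y := by
  obtain ⟨-, -, -, v, a, a', ha, rfl, hx, hy⟩ := hxy
  simp only [disjoint_insert_right, disjoint_singleton_right] at hAS
  have hva : G.Adj v a := (is3Clique_triple_iff.1 hx).2.2
  have hva' : G.Adj v a' := (is3Clique_triple_iff.1 hy).1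
  have hy' : G.Adj a' y := (is3Clique_triple_iff.1 hy).2.2
  have hA₁ := hA.snoc (Q := {v, a}) (x := v) (by simp [hAS.1, hAS.2.1]) (card_pair hva.ne)
    (by simp) hx.isClique
  have hA₂ := hA₁.snoc (Q := {a', y}) (x := y) (by grind [Finset.disjoint_left, hva'.ne])
    (card_pair hy'.ne) (by simp) hy.isClique
  exact ⟨_, by grind, hA₂⟩

end Cherry

section Thick

variable {V : Type*} [Fintype V] {G M : SimpleGraph V} {f k l m E : ℕ}
  {K U Z : Finset V} {x y z : V}

/-- The edges of `G` outside `U` whose ends have at least about a sixth of all vertices as common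
neighbours. -/
def thickGraph (G : SimpleGraph V) (U : Finset V) : SimpleGraph V where
  Adj x y := G.Adj x y ∧ x ∉ U ∧ y ∉ U ∧ Fintype.card V ≤ 6 * #{z | G.Adj x z ∧ G.Adj y z} + 3
  symm := ⟨fun x y ⟨hxy, hx, hy, h⟩ => ⟨hxy.symm, hy, hx, by simpa only [and_comm] using h⟩⟩
  loopless := ⟨fun x h => h.1.ne rfl⟩

theorem exists_adj_adj_of_thickGraph_adj (hxy : (thickGraph G U).Adj x y)
    (hZ : 6 * #Z + 3 < Fintype.card V) : ∃ z ∉ Z, G.Adj x z ∧ G.Adj y z := by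
  obtain ⟨z, hz, hzZ⟩ := exists_mem_notMem_of_card_lt_card
    (show #Z < #{z | G.Adj x z ∧ G.Adj y z} by have := hxy.2.2.2; lia)
  exact ⟨z, hzZ, (mem_filter.1 hz).2⟩

/-- Inclusion–exclusion for the three neighbourhoods, each of which has about half of all
vertices. -/
theorem NearTuran.exists_thick (h : NearTuran G 2 m) (hxy : G.Adj x y) (hxz : G.Adj x z)
    (hyz : G.Adj y z) (hx : x ∉ U) (hy : y ∉ U) (hz : z ∉ U) :
    (thickGraph G U).Adj x y ∨ (thickGraph G U).Adj x z ∨ (thickGraph G U).Adj y z := by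
  by_contra! hcon
  obtain ⟨hnxy, hnxz, hnyz⟩ := hcon
  simp only [thickGraph, hxy, hxz, hyz, hx, hy, hz, not_false_eq_true, true_and, not_le]
    at hnxy hnxz hnyz
  have hpoint : ∀ u, (if G.Adj x u then 1 else 0) + (if G.Adj y u then 1 else 0) +
      (if G.Adj z u then 1 else 0) ≤ 1 + (if G.Adj x u ∧ G.Adj y u then 1 else 0) +
      (if G.Adj x u ∧ G.Adj z u then 1 else 0) + (if G.Adj y u ∧ G.Adj z u then 1 else 0) := by
    intro u
    by_cases G.Adj x u <;> by_cases G.Adj y u <;> by_cases G.Adj z u <;> simp [*]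
  have hsum := sum_le_sum fun u (_ : u ∈ univ) => hpoint u
  simp only [sum_add_distrib, ← card_filter, sum_const, card_univ, smul_eq_mul, mul_one] at hsum
  have := card_adj_add_card_nonNbr G x
  have := card_adj_add_card_nonNbr G y
  have := card_adj_add_card_nonNbr G z
  have := h.card_nonNbr_le x
  have := h.card_nonNbr_le y
  have := h.card_nonNbr_le z
  have := h.mul_le
  lia

theorem NearTuran.not_isNClique_sdiff_thickGraph (h : NearTuran G 2 m) (hK : K ⊆ Uᶜ) :
    ¬ (G \ thickGraph G U).IsNClique 3 K := by
  intro hclique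
  obtain ⟨x, y, z, hxy, hxz, hyz, rfl⟩ := is3Clique_iff.1 hclique
  simp only [insert_subset_iff, singleton_subset_iff, mem_compl] at hK
  rcases h.exists_thick hxy.1 hxz.1 hyz.1 hK.1 hK.2.1 hK.2.2 with h | h | h
  exacts [hxy.2 h, hxz.2 h, hyz.2 h]

theorem mul_le_sum_cherryGraph {v a a' : V} (ha : a ≠ a') (hva : (thickGraph G ∅).Adj v a)
    (hva' : (thickGraph G ∅).Adj v a') (hl : 6 * (l + 1 + #U) + 3 ≤ Fintype.card V) :
    (l + 1) * l ≤ ∑ x, #{y | (cherryGraph G U {v, a, a'}).Adj x y} := by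
  have hcommon : ∀ b, (thickGraph G ∅).Adj v b →
      l + 1 ≤ #(({x | G.Adj v x ∧ G.Adj b x} : Finset V) \ U) := fun b hb => by
    have := hb.2.2.2
    have := le_card_sdiff U {x | G.Adj v x ∧ G.Adj b x}
    lia
  refine (Nat.mul_le_mul_right l (hcommon a hva)).trans ?_
  refine le_trans ?_ (sum_le_sum_of_subset
    (subset_univ (({x | G.Adj v x ∧ G.Adj a x} : Finset V) \ U)))
  rw [← smul_eq_mul]
  refine card_nsmul_le_sum _ _ _ fun x hx => ?_
  refine (Nat.le_sub_one_of_lt (hcommon a' hva')).trans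
    ((pred_card_le_card_erase (a := x)).trans (card_le_card fun y hy => ?_))
  simp only [mem_erase, mem_sdiff, mem_filter, mem_univ, true_and] at hx hy ⊢
  exact ⟨hy.1.symm, hx.2, hy.2.2, v, a, a', ha, rfl,
    is3Clique_triple_iff.2 ⟨hx.1.1.symm, hx.1.2.symm, hva.1⟩,
    is3Clique_triple_iff.2 ⟨hva'.1, hy.2.1.1, hy.2.1.2⟩⟩

theorem exists_hitting_thick (hfree : ∀ A p, ¬ HasCliquePath G 2 (2 * (f + 1)) A p)
    (hn₁ : 60000 * f + 3000 ≤ Fintype.card V)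
    (hn₂ : 74 * (f + 1) * (37 * f + 1) < Fintype.card V) :
    ∃ U : Finset V, #U ≤ 111 * f + 3 ∧ ∀ x y z, (thickGraph G U).Adj x y →
      (thickGraph G U).Adj x z → y = z := by
  rcases exists_pairwiseDisjoint_or_hitting (c := 3) (P := fun s : Finset V =>
    ∃ v a a', a ≠ a' ∧ (thickGraph G ∅).Adj v a ∧ (thickGraph G ∅).Adj v a' ∧ s = {v, a, a'})
    (by rintro s ⟨v, a, a', -, -, -, rfl⟩; exact ⟨card_le_three, insert_nonempty _ _⟩)
    (37 * f + 1) with ⟨I, hI, hIP, hd⟩ | ⟨U, hUc, hU⟩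
  · exfalso
    have hUcard : #(I.biUnion id) ≤ 111 * f + 3 := by
      refine (card_biUnion_le_card_mul I id 3 fun s hs => ?_).trans (by lia)
      obtain ⟨v, a, a', -, -, -, rfl⟩ := hIP s hs
      exact card_le_three
    obtain ⟨l, hl⟩ : ∃ l, l = (Fintype.card V - 3) / 6 - (111 * f + 4) := ⟨_, rfl⟩
    obtain ⟨A, p, hA⟩ := exists_hasCliquePath_of_labels (G := G) (q := 2) (c := 2) (j := f)
      (N := (l + 1) * l) (R := cherryGraph G (I.biUnion id)) hd
      (fun s _ x y hxy s' hs' hx => hxy.2.1 (mem_biUnion.2 ⟨s', hs', hx⟩))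
      (fun s hs x y l A hxy hA hAs hyA => hA.exists_of_cherryGraph_adj hxy hAs hyA
        fun hys => hxy.2.2.1 (mem_biUnion.2 ⟨s, hs, hys⟩))
      (fun s hs => by
        obtain ⟨v, a, a', ha, hva, hva', rfl⟩ := hIP s hs
        exact mul_le_sum_cherryGraph ha hva hva' (by lia))
      (by
        rw [hI]
        have hl₁ : 987 * Fintype.card V ≤ 6000 * l := by lia
        have hl₂ : 987 * Fintype.card V ≤ 6000 * (l + 1) := by lia
        have := Nat.mul_le_mul hl₂ hl₁
        have : Fintype.card V * Fintype.card V ≤ 37 * ((l + 1) * l) := by nlinarith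
        have := Nat.mul_lt_mul_of_pos_right hn₂ (show 0 < Fintype.card V by lia)
        nlinarith)
    exact hfree A p hA
  · refine ⟨U, by lia, fun x y z hxy hxz => by_contra fun hyz => ?_⟩
    refine hU _ ⟨x, y, z, hyz, ⟨hxy.1, by simp, by simp, hxy.2.2.2⟩,
      ⟨hxz.1, by simp, by simp, hxz.2.2.2⟩, rfl⟩ ?_
    simp [hxy.2.1, hxy.2.2.1, hxz.2.2.1]

theorem exists_adj_notMem_of_lt (hM : ∀ x y z, M.Adj x y → M.Adj x z → y = z) (S A : Finset V)
    (h : Fintype.card V + 2 * #A < #S + #{x | ∃ y, M.Adj x y}) :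
    ∃ x ∈ S, ∃ y, M.Adj x y ∧ x ∉ A ∧ y ∉ A := by
  have hpartners : #(A.biUnion fun x => {y | M.Adj x y}) ≤ #A * 1 :=
    card_biUnion_le_card_mul _ _ _ fun x _ => card_le_one.2 fun y hy z hz =>
      hM x y z (mem_filter.1 hy).2 (mem_filter.1 hz).2
  have hcard : #(A ∪ A.biUnion fun x => {y | M.Adj x y}) < #{x ∈ S | ∃ y, M.Adj x y} := by
    have := card_filter_add_card_filter_not (s := S) fun x => ∃ y, M.Adj x y
    have := card_filter_add_card_filter_not (s := univ) fun x => ∃ y, M.Adj x y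
    have := card_le_card (filter_subset_filter (fun x => ¬ ∃ y, M.Adj x y) (subset_univ S))
    rw [card_univ] at *
    have := card_union_le A (A.biUnion fun x => {y | M.Adj x y})
    lia
  obtain ⟨x, hx, hxA⟩ := exists_mem_notMem_of_card_lt_card hcard
  obtain ⟨hxS, y, hxy⟩ := mem_filter.1 hx
  simp only [mem_union, mem_biUnion, mem_filter, mem_univ, true_and, not_or, not_exists,
    not_and] at hxA
  exact ⟨x, hxS, y, hxy, hxA.1, fun hy => hxA.2 y hy hxy.symm⟩

theorem exists_hasCliquePath_of_thick_matching
    (hM : ∀ x y z, (thickGraph G U).Adj x y → (thickGraph G U).Adj x z → y = z)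
    (hn : 5 * Fintype.card V + 24 * k + 20 ≤ 6 * #{x | ∃ y, (thickGraph G U).Adj x y}) :
    ∃ A p, HasCliquePath G 2 k A p := by
  have : #{x | ∃ y, (thickGraph G U).Adj x y} ≤ Fintype.card V := card_le_univ _
  suffices ∀ t ≤ k, ∃ A p p', HasCliquePath G 2 t A p ∧ (thickGraph G U).Adj p p' ∧ p' ∉ A by
    obtain ⟨A, p, -, hA, -⟩ := this k le_rfl
    exact ⟨A, p, hA⟩
  intro t ht
  induction t with
  | zero =>
    obtain ⟨x, -, y, hxy, -⟩ := exists_adj_notMem_of_lt hM univ ∅ (by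
      rw [card_univ, card_empty]
      lia)
    exact ⟨{x}, x, y, .single x, hxy, by simpa using hxy.ne'⟩
  | succ t ih =>
    obtain ⟨A, p, p', hA, hpp', hp'⟩ := ih (by lia)
    obtain ⟨x, hx, y, hxy, hxA, hyA⟩ := exists_adj_notMem_of_lt hM
      {z | G.Adj p z ∧ G.Adj p' z} A (by
        have := hpp'.2.2.2
        rw [hA.card_eq]
        lia)
    obtain ⟨hpx, hp'x⟩ := (mem_filter.1 hx).2
    refine ⟨_, x, y, hA.snoc (Q := {p', x}) (by simp [hp', hxA]) (card_pair hp'x.ne) (by simp)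
      (is3Clique_triple_iff.2 ⟨hpp'.1, hpx, hp'x⟩).isClique, hxy, ?_⟩
    have hyp' : y ≠ p' := fun h => hxA <| by
      rw [hM p' x p (h ▸ hxy.symm) hpp'.symm]
      exact hA.end_mem
    simp [hyA, hyp', hxy.ne']

/-- A clique-path through all vertices of `K` can be prolonged by a triangle on a thick edge at
both ends, unless some vertex of `K` has few neighbours on thick edges. -/
theorem NearTuran.exists_card_thick_le (h : NearTuran G 2 m)
    (hM : ∀ x y z, (thickGraph G U).Adj x y → (thickGraph G U).Adj x z → y = z)
    (hfree : ∀ A p, ¬ HasCliquePath G 2 (2 * #K + 2) A p) (hne : K.Nonempty)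
    (hK : ∀ w ∈ K, #(nonNbr G w) + E ≤ m) (hE : 5 * #K + 5 ≤ E)
    (hn : 24 * #K + 9 < Fintype.card V) :
    ∃ w ∈ K, #{x | ∃ y, (thickGraph G U).Adj x y} ≤ #(nonNbr G w) + 8 * #K + 2 := by
  by_contra! hcon
  have hthick : ∀ w ∈ K, ∀ A : Finset V, #A ≤ 4 * #K + 1 → ∃ x y z, G.Adj w x ∧
      G.IsNClique 3 {x, y, z} ∧ Disjoint A {x, y, z} := by
    intro w hw A hA
    obtain ⟨x, hx, y, hxy, hxA, hyA⟩ := exists_adj_notMem_of_lt hM {x | G.Adj w x} A (by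
      have := card_adj_add_card_nonNbr G w
      have := hcon w hw
      lia)
    obtain ⟨z, hzA, hxz, hyz⟩ := exists_adj_adj_of_thickGraph_adj hxy (Z := A) (by lia)
    exact ⟨x, y, z, (mem_filter.1 hx).2, is3Clique_triple_iff.2 ⟨hxy.1, hxz, hyz⟩,
      by simp [hxA, hyA, hzA]⟩
  obtain ⟨a, ha⟩ := hne
  obtain ⟨x₁, y₁, z₁, hax₁, hT₁, hKT₁⟩ := hthick a ha K (by lia)
  obtain ⟨A, u, hu, hA, -⟩ := h.exists_snoc_thread (Z := ∅) (E := E)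
    (.of_isClique hT₁.isClique hT₁.card_eq (mem_insert_self x₁ _) one_le_two) hK ha hax₁.symm
    hKT₁.symm (by
      rw [hT₁.card_eq, card_empty]
      lia)
  have hlen : 1 + 2 * #K - 1 = 2 * #K := by lia
  rw [hlen] at hA
  obtain ⟨x₂, y₂, z₂, hux₂, hT₂, hAT₂⟩ := hthick u hu A (by rw [hA.card_eq]; lia)
  simp only [disjoint_insert_right, disjoint_singleton_right] at hAT₂
  obtain ⟨A', hA', hZ⟩ := h.exists_snoc (Z := {y₂, z₂}) (E := E) hA hux₂ hAT₂.1 (.inl (hK u hu))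
    (by have := card_le_two (a := y₂) (b := z₂); rw [hA.card_eq]; lia)
  obtain ⟨hxy₂, hxz₂, hyz₂⟩ := is3Clique_triple_iff.1 hT₂
  refine hfree _ _ (hA'.snoc (Q := {y₂, z₂}) (x := y₂) ?_ (card_pair hyz₂.ne) (by simp)
    hT₂.isClique)
  exact Finset.disjoint_right.2 fun z hz hzA' => by grind [hxy₂.ne, hxz₂.ne]

theorem sum_card_adj_le_of_matching (hM : ∀ x y z, M.Adj x y → M.Adj x z → y = z)
    (S : Finset V) : ∑ x ∈ S, #{y ∈ S | M.Adj x y} ≤ #{x | ∃ y, M.Adj x y} := by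
  rw [card_filter]
  refine le_trans (sum_le_sum fun x _ => ?_) (sum_le_sum_of_subset (subset_univ S))
  split_ifs with hx
  · exact card_le_one.2 fun y hy z hz => hM x y z (mem_filter.1 hy).2 (mem_filter.1 hz).2
  · rw [filter_false_of_mem fun y _ hxy => hx ⟨y, hxy⟩, card_empty]

theorem sq_add_le_of_le {s : ℕ} (hf : 1 ≤ f) (hs : s ≤ 111 * f + 3) :
    s ^ 2 + 2 * s * ((2 * f + 6) * (2 + 1)) + 2 * f ^ 2 + 2 ≤ 18472 * f ^ 2 := by
  calc s ^ 2 + 2 * s * ((2 * f + 6) * (2 + 1)) + 2 * f ^ 2 + 2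
      ≤ (114 * f) ^ 2 + 2 * (114 * f) * (8 * f * (2 + 1)) + 2 * f ^ 2 + 2 * f ^ 2 := by
        gcongr
        · lia
        · lia
        · lia
        · nlinarith
    _ = 18472 * f ^ 2 := by ring

theorem NearTuran.exists_large_degree_of_two (h : NearTuran G 2 m) (hk : 3 ≤ k)
    (hf₁ : 2 * f + 1 ≤ k) (hf₂ : k ≤ 2 * f + 2)
    (hn : 9 * k ^ 4 * (2 + 1) ^ 5 ≤ Fintype.card V) (hfree : (cliquePath k (2 + 1)).Free G)
    (he : f * (Fintype.card V - f) + (turanGraph (Fintype.card V - f) 2).edgeSet.ncard ≤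
      G.edgeSet.ncard) :
    ∃ W : Finset V, #W = f ∧ ∀ w ∈ W, #(nonNbr G w) + (2 * f + 6) * (2 + 1) ≤ m ∧
      6 * #(nonNbr G w) ≤ Fintype.card V := by
  have hf : f ≤ f ^ 2 := Nat.le_self_pow two_ne_zero f
  have hn' : 177147 * f ^ 2 ≤ Fintype.card V := by
    have hfk : 9 * f ≤ k ^ 2 := by nlinarith
    calc 177147 * f ^ 2 = 9 * (9 * f) ^ 2 * (2 + 1) ^ 5 := by ring
      _ ≤ 9 * (k ^ 2) ^ 2 * (2 + 1) ^ 5 := by gcongr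
      _ = 9 * k ^ 4 * (2 + 1) ^ 5 := by ring
      _ ≤ _ := hn
  have hnot : ∀ l A p, k ≤ l → ¬ HasCliquePath G 2 l A p := fun l A p hl hA => by
    obtain ⟨A', p', hA'⟩ := hA.exists_of_le hl
    exact hA'.not_free hfree
  obtain ⟨U, hUcard, hM⟩ := exists_hitting_thick (f := f) (fun A p => hnot _ A p (by lia)) (by lia)
    (by nlinarith)
  have hsum := h.card_mul_add_sum_le (H := G \ thickGraph G U) (F := thickGraph G U)
    (by rw [sdiff_sup_self]; exact le_sup_left) (fun K => h.not_isNClique_sdiff_thickGraph)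
    (by lia) he ((2 * f + 6) * (2 + 1))
  have hD := sq_add_le_of_le (by lia : 1 ≤ f) hUcard
  have hmatching := sum_card_adj_le_of_matching hM Uᶜ
  set W := {w ∈ U | #(nonNbr G w) + (2 * f + 6) * (2 + 1) ≤ m}
  have hWlarge : ∀ w ∈ W, #(nonNbr G w) + (2 * f + 6) * (2 + 1) ≤ m := fun w hw =>
    (mem_filter.1 hw).2
  have hWf : #W = f := by
    refine (h.card_le_of_free hf₂ le_rfl hfree hWlarge).eq_or_lt.resolve_right fun hlt => ?_
    have := Nat.mul_le_mul_right (2 * Fintype.card V) hlt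
    obtain ⟨A, p, hA⟩ := exists_hasCliquePath_of_thick_matching (k := k) hM (by lia)
    exact hnot _ A p le_rfl hA
  obtain ⟨w₀, hw₀, hC⟩ := h.exists_card_thick_le hM (fun A p => hnot _ A p (by lia))
    (card_pos.1 (by lia)) hWlarge (by lia) (by lia)
  refine ⟨W, hWf, fun w hw => ⟨hWlarge w hw, ?_⟩⟩
  have := single_le_sum (f := fun w => #(nonNbr G w)) (fun _ _ => Nat.zero_le _) hw
  have := single_le_sum (f := fun w => #(nonNbr G w)) (fun _ _ => Nat.zero_le _) hw₀
  rw [hWf] at hsum hC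
  lia

end Thick

section Extension

variable {V ι : Type*} {G : SimpleGraph V} {q θ : ℕ} {C : ι → Finset V} {K K₁ K₂ T₁ T₂ Z : Finset V}
  {J J₁ J₂ : Finset ι} {p : V}

theorem exists_hasCliquePath_two (hq : 1 ≤ q) (hT₁ : G.IsNClique (q + 1) T₁)
    (hT₂ : G.IsNClique (q + 1) T₂) (hp : T₁ ∩ T₂ = {p}) : ∃ A x, HasCliquePath G q 2 A x := by
  have hp' : p ∈ T₁ ∩ T₂ := hp ▸ mem_singleton_self p
  rw [mem_inter] at hp'
  obtain ⟨x, hx, hxp⟩ := exists_mem_ne (by have := hT₂.card_eq; lia : 1 < #T₂) p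
  refine ⟨_, x, (HasCliquePath.of_isClique hT₁.isClique hT₁.card_eq hp'.1 hq).snoc
    (Q := T₂.erase p) ?_ ?_ (mem_erase.2 ⟨hxp, hx⟩) ?_⟩
  · exact Finset.disjoint_right.2 fun y hy hy₁ => ne_of_mem_erase hy
      (mem_singleton.1 (hp ▸ mem_inter.2 ⟨hy₁, mem_of_mem_erase hy⟩))
  · rw [card_erase_of_mem hp'.2, hT₂.card_eq, Nat.add_sub_cancel]
  · rw [insert_erase hp'.2]
    exact hT₂.isClique

theorem exists_isClique_union (hK : G.IsClique (K : Set V))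
    (hKJ : ∀ u ∈ K, ∀ i ∈ J, #{x ∈ C i | ¬ G.Adj u x} ≤ θ)
    (hJ : ∀ i j, i ≠ j → ∀ u ∈ C i, #{x ∈ C j | ¬ G.Adj u x} ≤ θ)
    (hC : ∀ i, (#K + #J) * θ + #Z < #(C i)) :
    ∃ Q : Finset V, #Q = #J ∧ Disjoint Q (K ∪ Z) ∧ G.IsClique (K ∪ Q : Finset V) := by
  induction J using Finset.induction_on generalizing K with
  | empty => exact ⟨∅, by simpa using hK⟩
  | insert i J hi ih =>
    simp only [forall_mem_insert] at hKJ
    rw [card_insert_of_notMem hi] at hC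
    obtain ⟨x, hxC, hx⟩ : ∃ x ∈ C i, x ∉ K.biUnion (fun u => {x ∈ C i | ¬ G.Adj u x}) ∪ Z := by
      refine exists_mem_notMem_of_card_lt_card (((card_union_le _ _).trans (Nat.add_le_add_right
        (card_biUnion_le_card_mul _ _ θ fun u hu => (hKJ u hu).1) _)).trans_lt ?_)
      exact lt_of_le_of_lt (by gcongr; lia) (hC i)
    simp only [mem_union, mem_biUnion, mem_filter, not_or, not_exists, not_and, not_not] at hx
    have hxK : x ∉ K := fun h => (hx.1 x h hxC).ne rfl
    obtain ⟨Q, hQ, hQd, hclique⟩ := ih (K := insert x K)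
      (by rw [coe_insert, isClique_insert]; exact ⟨hK, fun u hu _ => (hx.1 u hu hxC).symm⟩)
      (forall_mem_insert _ _ _ |>.2 ⟨fun j hj => hJ i j (fun h => hi (h ▸ hj)) x hxC,
        fun u hu => (hKJ u hu).2⟩)
      (fun j => by rw [card_insert_of_notMem hxK, add_assoc, add_comm 1]; exact hC j)
    rw [insert_union, disjoint_insert_right] at hQd
    refine ⟨insert x Q, ?_, ?_, ?_⟩
    · rw [card_insert_of_notMem hQd.1, hQ, card_insert_of_notMem hi]
    · exact disjoint_insert_left.2 ⟨by simp [hxK, hx.2], hQd.2⟩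
    · rwa [union_insert, ← insert_union]

theorem exists_hasCliquePath_two_of_inter_eq (hq : 1 ≤ q) (hK₁ : G.IsClique (K₁ : Set V))
    (hK₂ : G.IsClique (K₂ : Set V)) (hp : K₁ ∩ K₂ = {p}) (hc₁ : #K₁ + #J₁ = q + 1)
    (hc₂ : #K₂ + #J₂ = q + 1) (hKJ₁ : ∀ u ∈ K₁, ∀ i ∈ J₁, #{x ∈ C i | ¬ G.Adj u x} ≤ θ)
    (hKJ₂ : ∀ u ∈ K₂, ∀ i ∈ J₂, #{x ∈ C i | ¬ G.Adj u x} ≤ θ)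
    (hC : ∀ i j, i ≠ j → ∀ u ∈ C i, #{x ∈ C j | ¬ G.Adj u x} ≤ θ)
    (hlarge : ∀ i, (q + 1) * (θ + 1) < #(C i)) : ∃ A x, HasCliquePath G q 2 A x := by
  obtain ⟨Q₁, hQ₁, hd₁, hT₁⟩ := exists_isClique_union (Z := K₂) hK₁ hKJ₁ hC fun i => by
    have := hlarge i
    rw [hc₁]
    lia
  have hcT₁ : #(K₁ ∪ Q₁) = q + 1 := by
    rw [card_union_of_disjoint (disjoint_union_right.1 hd₁).1.symm, hQ₁, hc₁]
  obtain ⟨Q₂, hQ₂, hd₂, hT₂⟩ := exists_isClique_union (Z := K₁ ∪ Q₁) hK₂ hKJ₂ hC fun i => by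
    have := hlarge i
    rw [hc₂, hcT₁]
    lia
  have hcT₂ : #(K₂ ∪ Q₂) = q + 1 := by
    rw [card_union_of_disjoint (disjoint_union_right.1 hd₂).1.symm, hQ₂, hc₂]
  refine exists_hasCliquePath_two hq ⟨hT₁, hcT₁⟩ ⟨hT₂, hcT₂⟩ (p := p) ?_
  simp only [disjoint_union_right] at hd₁ hd₂
  rw [union_inter_distrib_right, inter_union_distrib_left, hp, inter_union_distrib_left,
    disjoint_iff_inter_eq_empty.1 hd₁.2, disjoint_iff_inter_eq_empty.1 hd₂.2.1.symm,
    disjoint_iff_inter_eq_empty.1 hd₂.2.2.symm]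
  simp

end Extension

section Coloring

variable {V : Type*} {G : SimpleGraph V} {q m : ℕ} {S : Finset V}

theorem exists_coloring_of_lt (hq : 2 ≤ q) (hne : S.Nonempty)
    (hS : ∀ K ⊆ S, ¬ G.IsNClique (q + 1) K)
    (hd : ∀ x ∈ S, (3 * q - 4) * #S < (3 * q - 1) * #{y ∈ S | G.Adj x y}) :
    ∃ c : V → Fin q, ∀ x ∈ S, ∀ y ∈ S, G.Adj x y → c x ≠ c y := by
  have hcol : (G.induce (S : Set V)).Colorable q := by
    have : Nonempty (S : Set V) := hne.to_subtype
    refine colorable_of_cliqueFree_lt_minDegree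
      ((cliqueFree_induce_iff _ _ _).2 fun K hK => hS K (mod_cast hK)) ?_
    obtain ⟨x, hx⟩ := exists_minimal_degree_vertex (G.induce (S : Set V))
    have hdeg : (G.induce (S : Set V)).degree x = #{y ∈ S | G.Adj x y} := by
      rw [← card_neighborFinset_eq_degree, ← card_map (.subtype (· ∈ (S : Set V)))]
      congr 1
      ext y
      simp [and_comm]
    have hcard : Fintype.card (S : Set V) = #S := Fintype.card_coe S
    rw [hx, hdeg, hcard]
    exact Nat.div_lt_of_lt_mul (hd x x.2)
  obtain ⟨c⟩ := hcol
  refine ⟨fun x => if h : x ∈ S then c ⟨x, h⟩ else ⟨0, by lia⟩, fun x hx y hy hxy => ?_⟩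
  dsimp only
  rw [dif_pos hx, dif_pos hy]
  exact c.valid (v := ⟨x, hx⟩) (w := ⟨y, hy⟩) hxy

variable [Fintype V]

theorem NearTuran.exists_matching_forall_not_isNClique (h : NearTuran G q m)
    (hn : 64 * (q + 1) ^ 5 ≤ Fintype.card V) (hfree : (cliquePath 2 (q + 1)).Free G) :
    ∃ (U : Finset V) (M : SimpleGraph V), #U ≤ 40 * (q + 1) ∧
      (∀ x y z, M.Adj x y → M.Adj x z → y = z) ∧ ∀ K ⊆ Uᶜ, ¬ (G \ M).IsNClique (q + 1) K := by
  rcases h.two_le.eq_or_lt with rfl | hq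
  · obtain ⟨U, hU, hM⟩ := exists_hitting_thick (f := 0) (fun A p hA => hA.not_free hfree) (by lia)
      (by lia)
    exact ⟨U, thickGraph G U, by lia, hM, fun K hK => h.not_isNClique_sdiff_thickGraph hK⟩
  · have hpow : 256 * (q + 1) ≤ (q + 1) ^ 5 := by
      calc 256 * (q + 1) = 4 ^ 4 * (q + 1) := by norm_num
        _ ≤ (q + 1) ^ 4 * (q + 1) := by gcongr; lia
        _ = (q + 1) ^ 5 := by ring
    obtain ⟨U, hU, hK⟩ := h.exists_hitting hq (by lia) hfree (by lia) (by lia)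
    refine ⟨U, ⊥, by lia, by simp, fun K hKU hclique => hK K ?_ ?_⟩
    · rw [sdiff_bot] at hclique
      exact ⟨hclique.isClique, hclique.card_eq⟩
    · exact Finset.disjoint_left.2 fun x hx => mem_compl.1 (hKU hx)

theorem NearTuran.exists_coloring (h : NearTuran G q m)
    (hn : 64 * (q + 1) ^ 5 ≤ Fintype.card V) (hfree : (cliquePath 2 (q + 1)).Free G) :
    ∃ (U : Finset V) (c : V → Fin q), #U ≤ 40 * (q + 1) ∧
      ∀ v ∉ U, #{y ∈ Uᶜ | G.Adj v y ∧ c v = c y} ≤ 1 := by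
  have hq := h.two_le
  obtain ⟨U, M, hU, hM, hK⟩ := h.exists_matching_forall_not_isNClique hn hfree
  generalize hH : G \ M = H at hK
  have hM1 : ∀ x, #{y | M.Adj x y} ≤ 1 := fun x => card_le_one.2 fun y hy z hz =>
    hM x y z (mem_filter.1 hy).2 (mem_filter.1 hz).2
  have hpow : 27 * (q + 1) ^ 2 ≤ (q + 1) ^ 5 := by
    calc 27 * (q + 1) ^ 2 = 3 ^ 3 * (q + 1) ^ 2 := by norm_num
      _ ≤ (q + 1) ^ 3 * (q + 1) ^ 2 := by gcongr; lia
      _ = (q + 1) ^ 5 := by ring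
  have hUn : #Uᶜ + #U = Fintype.card V := card_compl_add_card U
  have hdeg : ∀ x, #Uᶜ ≤ #{y ∈ Uᶜ | H.Adj x y} + m + 1 := by
    intro x
    have hsub : Uᶜ ⊆ ({y ∈ Uᶜ | H.Adj x y} ∪ nonNbr G x) ∪
        ({y | M.Adj x y} : Finset V) := by
      intro y hy
      simp only [mem_union, mem_filter, mem_nonNbr, ← hH, sdiff_adj, mem_univ, true_and, hy]
      tauto
    exact (card_le_card hsub).trans ((card_union_le _ _).trans (Nat.add_le_add
      ((card_union_le _ _).trans (Nat.add_le_add_left (h.card_nonNbr_le x) _)) (hM1 x)))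
  obtain ⟨c, hc⟩ := exists_coloring_of_lt hq (card_pos.1 (by nlinarith)) hK fun x _ => by
    have hqm := h.mul_le
    obtain ⟨d, rfl⟩ := Nat.exists_eq_add_of_le' hq
    rw [show 3 * (d + 2) - 4 = 3 * d + 2 by lia, show 3 * (d + 2) - 1 = 3 * d + 5 by lia]
    have hm : (d + 2) * ((3 * d + 5) * (m + 1)) < (d + 2) * (3 * #Uᶜ) := by nlinarith
    have hm := Nat.lt_of_mul_lt_mul_left hm
    have := Nat.mul_le_mul_left (3 * d + 5) (hdeg x)
    lia
  refine ⟨U, c, hU, fun v hv => (card_le_card fun y hy => ?_).trans (hM1 v)⟩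
  simp only [mem_filter, mem_univ, true_and] at hy ⊢
  by_contra hvy
  exact hc v (mem_compl.2 hv) y hy.1 (hH ▸ ⟨hy.2.1, hvy⟩) hy.2.2

end Coloring

section ColorClass

variable {V : Type*} [Fintype V] {G : SimpleGraph V} {q m : ℕ} {U : Finset V} {c : V → Fin q}
  {i j : Fin q} {v x : V}

/-- The vertices outside the exceptional set `U` that are coloured `i` by `c`. -/
noncomputable def colorClass (U : Finset V) (c : V → Fin q) (i : Fin q) : Finset V :=
  {x ∈ Uᶜ | c x = i}

@[simp]
theorem mem_colorClass : x ∈ colorClass U c i ↔ x ∉ U ∧ c x = i := by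
  rw [colorClass, mem_filter, mem_compl]

theorem NearTuran.card_colorClass_le (h : NearTuran G q m)
    (hc : ∀ v ∉ U, #{y ∈ Uᶜ | G.Adj v y ∧ c v = c y} ≤ 1) (i : Fin q) :
    #(colorClass U c i) ≤ m + 1 := by
  rcases (colorClass U c i).eq_empty_or_nonempty with hempty | ⟨v, hv⟩
  · simp [hempty]
  · rw [mem_colorClass] at hv
    have hsub : colorClass U c i ⊆ nonNbr G v ∪ {y ∈ Uᶜ | G.Adj v y ∧ c v = c y} := by
      intro x hx
      rw [mem_colorClass] at hx
      by_cases hvx : G.Adj v x <;> simp [hvx, hx, hv]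
    exact (card_le_card hsub).trans ((card_union_le _ _).trans
      (Nat.add_le_add (h.card_nonNbr_le v) (hc v hv.1)))

theorem NearTuran.le_card_colorClass (h : NearTuran G q m)
    (hc : ∀ v ∉ U, #{y ∈ Uᶜ | G.Adj v y ∧ c v = c y} ≤ 1) (i : Fin q) :
    m ≤ #(colorClass U c i) + #U + 2 * q := by
  have hUn : #Uᶜ + #U = Fintype.card V := card_compl_add_card U
  have hpartition : #Uᶜ = ∑ j, #(colorClass U c j) :=
    card_eq_sum_card_fiberwise (f := c) (t := univ) fun x _ => mem_univ _
  have hothers : ∑ j ∈ univ.erase i, #(colorClass U c j) ≤ (q - 1) * (m + 1) := by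
    refine (sum_le_card_nsmul _ _ (m + 1) fun j _ => h.card_colorClass_le hc j).trans ?_
    rw [card_erase_of_mem (mem_univ i), card_univ, Fintype.card_fin, smul_eq_mul]
  rw [← add_sum_erase _ _ (mem_univ i)] at hpartition
  have hqm := h.mul_le
  obtain ⟨d, rfl⟩ := Nat.exists_eq_add_of_le' h.two_le
  rw [show d + 2 - 1 = d + 1 by lia] at hothers
  lia

theorem NearTuran.card_not_adj_add_card_colorClass_le (h : NearTuran G q m) (v : V) (hij : i ≠ j) :
    #{x ∈ colorClass U c i | ¬ G.Adj v x} + #(colorClass U c j) ≤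
      m + #{x ∈ colorClass U c j | G.Adj v x} := by
  have hdisj : Disjoint {x ∈ colorClass U c i | ¬ G.Adj v x}
      {x ∈ colorClass U c j | ¬ G.Adj v x} := by
    refine Finset.disjoint_left.2 fun x hi hj => hij ?_
    rw [mem_filter, mem_colorClass] at hi hj
    exact hi.1.2.symm.trans hj.1.2
  have hle : #({x ∈ colorClass U c i | ¬ G.Adj v x} ∪ {x ∈ colorClass U c j | ¬ G.Adj v x}) ≤ m :=
    (card_le_card (by grind [mem_nonNbr])).trans (h.card_nonNbr_le v)
  rw [card_union_of_disjoint hdisj] at hle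
  have := card_filter_add_card_filter_not (s := colorClass U c j) (G.Adj v ·)
  lia

theorem card_adj_colorClass_le (hc : ∀ v ∉ U, #{y ∈ Uᶜ | G.Adj v y ∧ c v = c y} ≤ 1) (hv : v ∉ U) :
    #{x ∈ colorClass U c (c v) | G.Adj v x} ≤ 1 := by
  refine (card_le_card fun x hx => ?_).trans (hc v hv)
  rw [mem_filter, mem_colorClass] at hx
  exact mem_filter.2 ⟨mem_compl.2 hx.1.1, hx.2, hx.1.2.symm⟩

theorem NearTuran.card_not_adj_colorClass_le (h : NearTuran G q m)
    (hc : ∀ v ∉ U, #{y ∈ Uᶜ | G.Adj v y ∧ c v = c y} ≤ 1) (hv : v ∉ U) (hi : i ≠ c v) :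
    #{x ∈ colorClass U c i | ¬ G.Adj v x} ≤ #U + 2 * q + 1 := by
  have := h.card_not_adj_add_card_colorClass_le (U := U) (c := c) v hi
  have := card_adj_colorClass_le hc hv
  have := h.le_card_colorClass hc (c v)
  lia

/-- Otherwise, `v` lies in two cliques formed by its neighbours in the colour classes. -/
theorem NearTuran.exists_card_adj_colorClass_le (h : NearTuran G q m)
    (hfree : (cliquePath 2 (q + 1)).Free G)
    (hc : ∀ v ∉ U, #{y ∈ Uᶜ | G.Adj v y ∧ c v = c y} ≤ 1) (v : V) :
    ∃ i, #{x ∈ colorClass U c i | G.Adj v x} ≤ (q + 1) * (#U + 2 * q + 2) ∧ (v ∉ U → i = c v) := by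
  by_cases hv : v ∈ U
  swap
  · exact ⟨c v, (card_adj_colorClass_le hc hv).trans (by nlinarith), fun _ => rfl⟩
  by_contra! hcon
  have hlarge i : (q + 1) * (#U + 2 * q + 2) < #{x ∈ colorClass U c i | G.Adj v x} := by
    by_contra! hle
    exact (hcon i hle).1 hv
  have hv' : ∀ u ∈ ({v} : Finset V), ∀ i ∈ (univ : Finset (Fin q)),
      #{x ∈ {x ∈ colorClass U c i | G.Adj v x} | ¬ G.Adj u x} ≤ #U + 2 * q + 1 := by
    simp [filter_filter]
  have hcard : #({v} : Finset V) + #(univ : Finset (Fin q)) = q + 1 := by simp [add_comm]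
  obtain ⟨A, p, hA⟩ := exists_hasCliquePath_two_of_inter_eq (by grind [h.two_le])
    (by simp) (by simp) (inter_self {v}) hcard hcard hv' hv' (fun i j hij u hu => by
      rw [mem_filter, mem_colorClass] at hu
      exact (card_le_card (filter_subset_filter _ (filter_subset _ _))).trans
        (h.card_not_adj_colorClass_le hc hu.1.1 (hu.1.2 ▸ hij.symm))) hlarge
  exact hA.not_free hfree

end ColorClass

section AlmostMultipartite

variable {V : Type*} {G : SimpleGraph V} {q m : ℕ}

/-- A colouring `c` of all vertices and large sets `C i` of vertices of colour `i` such that every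
vertex is adjacent to all but at most `θ` vertices of each set of another colour. -/
structure IsAlmostMultipartite (G : SimpleGraph V) (θ : ℕ) (c : V → Fin q)
    (C : Fin q → Finset V) : Prop where
  color_eq : ∀ i, ∀ x ∈ C i, c x = i
  card_not_adj_le : ∀ v i, i ≠ c v → #{x ∈ C i | ¬ G.Adj v x} ≤ θ
  lt_card : ∀ i, (q + 2) * (θ + 1) < #(C i)

theorem mul_add_add_lt_of_le {u : ℕ} (hq : 2 ≤ q) (hu : u ≤ 40 * (q + 1))
    (hm : 64 * (q + 1) ^ 5 ≤ q * m) :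
    (q + 2) * ((q + 1) * (u + 2 * q + 2) + u + 2 * q + 1) + u + 2 * q < m := by
  have hmul : q * (64 * (q + 1) ^ 4) ≤ q * m := by
    calc q * (64 * (q + 1) ^ 4) ≤ (q + 1) * (64 * (q + 1) ^ 4) := by gcongr; lia
      _ = 64 * (q + 1) ^ 5 := by ring
      _ ≤ q * m := hm
  have hu' : u + 2 * q + 2 ≤ 42 * (q + 1) := by lia
  calc (q + 2) * ((q + 1) * (u + 2 * q + 2) + u + 2 * q + 1) + u + 2 * q
      < (q + 2) * ((q + 2) * (u + 2 * q + 2)) + (u + 2 * q + 2) := by nlinarith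
    _ ≤ (q + 2) * ((q + 2) * (42 * (q + 1))) + 42 * (q + 1) := by gcongr
    _ ≤ (2 * (q + 1)) * ((2 * (q + 1)) * (42 * (q + 1))) + 24 * (q + 1) ^ 3 := by
        refine Nat.add_le_add (by gcongr <;> lia) ?_
        nlinarith [Nat.mul_le_mul hq hq]
    _ = 64 * 3 * (q + 1) ^ 3 := by ring
    _ ≤ 64 * (q + 1) * (q + 1) ^ 3 := by gcongr; lia
    _ = 64 * (q + 1) ^ 4 := by ring
    _ ≤ m := Nat.le_of_mul_le_mul_left hmul (by lia)

theorem NearTuran.exists_isAlmostMultipartite [Fintype V] (h : NearTuran G q m)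
    (hn : 64 * (q + 1) ^ 5 ≤ Fintype.card V) (hfree : (cliquePath 2 (q + 1)).Free G) :
    ∃ (θ : ℕ) (c : V → Fin q) (C : Fin q → Finset V), IsAlmostMultipartite G θ c C := by
  obtain ⟨U, c, hU, hc⟩ := h.exists_coloring hn hfree
  choose c' hlight hc' using h.exists_card_adj_colorClass_le hfree hc
  refine ⟨(q + 1) * (#U + 2 * q + 2) + #U + 2 * q, c', colorClass U c, ⟨?_, ?_, ?_⟩⟩
  · intro i x hx
    rw [mem_colorClass] at hx
    rw [hc' x hx.1, hx.2]
  · intro v i hi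
    have := h.card_not_adj_add_card_colorClass_le (U := U) (c := c) v hi
    have := h.le_card_colorClass hc (c' v)
    have := hlight v
    lia
  · intro i
    have := h.le_card_colorClass hc i
    have := mul_add_add_lt_of_le h.two_le hU (hn.trans h.card_le)
    lia

end AlmostMultipartite

section Monochromatic

variable {V : Type*} {G : SimpleGraph V} {q m θ : ℕ} {c : V → Fin q} {C : Fin q → Finset V}
  {K₁ K₂ S : Finset V} {l : Fin q} {a b a' b' p : V}

/-- A clique of `G` with exactly one repetition among the colours of its vertices. A clique on
`q + 1` vertices that extends it may be found by adding one vertex of each missing colour. -/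
structure IsNearRainbow (G : SimpleGraph V) (c : V → Fin q) (K : Finset V) : Prop where
  isClique : G.IsClique (K : Set V)
  card_eq : #K = #(K.image c) + 1

theorem isNearRainbow_pair (hab : G.Adj a b) (hc : c a = c b) : IsNearRainbow G c {a, b} :=
  ⟨by simp [hab], by simp [card_pair hab.ne, hc]⟩

theorem isNearRainbow_triple (hab : G.Adj a b) (hc : c a = c b) (hap : G.Adj a p)
    (hbp : G.Adj b p) (hp : c p ≠ c a) : IsNearRainbow G c {a, b, p} := by
  have hclique := is3Clique_triple_iff.2 ⟨hab, hap, hbp⟩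
  refine ⟨hclique.isClique, ?_⟩
  rw [hclique.card_eq, image_insert, image_insert, image_singleton, ← hc, insert_idem,
    card_pair hp.symm]

theorem IsAlmostMultipartite.not_free (h : IsAlmostMultipartite G θ c C) (hq : 1 ≤ q)
    (hK₁ : IsNearRainbow G c K₁) (hK₂ : IsNearRainbow G c K₂) (hp : K₁ ∩ K₂ = {p}) :
    ¬ (cliquePath 2 (q + 1)).Free G := by
  have hcard : ∀ {K}, IsNearRainbow G c K → #K + #(K.image c)ᶜ = q + 1 := fun {K} hK => by
    have := card_compl_add_card (K.image c)
    rw [Fintype.card_fin] at this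
    rw [hK.card_eq]
    lia
  have hmiss : ∀ K : Finset V, ∀ u ∈ K, ∀ i ∈ (K.image c)ᶜ, #{x ∈ C i | ¬ G.Adj u x} ≤ θ :=
    fun K u hu i hi => h.card_not_adj_le u i fun hiu =>
      mem_compl.1 hi (hiu ▸ mem_image_of_mem c hu)
  obtain ⟨A, x, hA⟩ := exists_hasCliquePath_two_of_inter_eq hq hK₁.isClique hK₂.isClique hp
    (hcard hK₁) (hcard hK₂) (hmiss K₁) (hmiss K₂)
    (fun i j hij u hu => h.card_not_adj_le u j (h.color_eq i u hu ▸ hij.symm))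
    fun i => (h.lt_card i).trans_le' (by gcongr; lia)
  exact hA.not_free

theorem IsAlmostMultipartite.eq_of_adj (h : IsAlmostMultipartite G θ c C)
    (hfree : (cliquePath 2 (q + 1)).Free G) (hab : G.Adj a b) (hc : c a = c b)
    (hab' : G.Adj a b') (hc' : c a = c b') : b = b' := by
  by_contra hne
  refine h.not_free (c a).pos (isNearRainbow_pair hab hc) (isNearRainbow_pair hab' hc') (p := a)
    ?_ hfree
  ext x
  have := hab.ne
  grind

theorem IsAlmostMultipartite.disjoint_pair (h : IsAlmostMultipartite G θ c C)
    (hfree : (cliquePath 2 (q + 1)).Free G) (hab : G.Adj a b) (hc : c a = c b)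
    (hab' : G.Adj a' b') (hc' : c a' = c b') (hne : s(a, b) ≠ s(a', b')) :
    Disjoint ({a, b} : Finset V) {a', b'} := by
  have heq := fun x y z hxy hc => h.eq_of_adj hfree (a := x) (b := y) (b' := z) hxy hc
  refine Finset.disjoint_left.2 fun x hx hx' => hne ?_
  simp only [mem_insert, mem_singleton] at hx hx'
  rcases hx with rfl | rfl <;> rcases hx' with rfl | rfl
  · rw [heq _ _ _ hab hc hab' hc']
  · rw [heq _ _ _ hab hc hab'.symm hc'.symm, Sym2.eq_swap]
  · rw [heq _ _ _ hab.symm hc.symm hab' hc', Sym2.eq_swap]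
  · rw [heq _ _ _ hab.symm hc.symm hab'.symm hc'.symm]

theorem IsAlmostMultipartite.exists_forall_adj (h : IsAlmostMultipartite G θ c C)
    (hS : #S ≤ q + 2) (hl : ∀ u ∈ S, l ≠ c u) : ∃ p, c p = l ∧ ∀ u ∈ S, G.Adj u p := by
  obtain ⟨p, hp, hpS⟩ : ∃ p ∈ C l, p ∉ S.biUnion fun u => {x ∈ C l | ¬ G.Adj u x} := by
    refine exists_mem_notMem_of_card_lt_card ((card_biUnion_le_card_mul _ _ θ fun u hu =>
      h.card_not_adj_le u l (hl u hu)).trans_lt ((h.lt_card l).trans_le' ?_))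
    gcongr
    lia
  simp only [mem_biUnion, mem_filter, not_exists, not_and, not_not] at hpS
  exact ⟨p, h.color_eq l p hp, fun u hu => hpS u hu hp⟩

/-- Otherwise, the two edges form triangles with a common neighbour of colour `l`. -/
theorem IsAlmostMultipartite.eq_of_ne (h : IsAlmostMultipartite G θ c C) (hq : 2 ≤ q)
    (hfree : (cliquePath 2 (q + 1)).Free G) (hab : G.Adj a b) (hc : c a = c b)
    (hab' : G.Adj a' b') (hc' : c a' = c b') (hl : l ≠ c a) (hl' : l ≠ c a') :
    s(a, b) = s(a', b') := by
  by_contra hne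
  have hdisj := h.disjoint_pair hfree hab hc hab' hc' hne
  obtain ⟨p, rfl, hp⟩ := h.exists_forall_adj (S := {a, b, a', b'}) (l := l)
    (card_le_four.trans (by lia)) (by grind)
  simp only [forall_mem_insert, mem_singleton, forall_eq] at hp
  refine h.not_free (by lia) (isNearRainbow_triple hab hc hp.1 hp.2.1 hl)
    (isNearRainbow_triple hab' hc' hp.2.2.1 hp.2.2.2 hl') (p := p) ?_ hfree
  simp only [disjoint_insert_left, disjoint_singleton_left, mem_insert, mem_singleton,
    not_or] at hdisj
  ext x
  simp only [mem_inter, mem_insert, mem_singleton]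
  grind

theorem IsAlmostMultipartite.exists_not_adj (h : IsAlmostMultipartite G θ c C)
    (hfree : (cliquePath 2 (q + 1)).Free G) (hab : G.Adj a b) (hc : c a = c b)
    (hab' : G.Adj a' b') (hc' : c a' = c b') (hne : c a' ≠ c a) :
    ∃ z, c z = c a ∧ ¬ G.Adj a' z := by
  by_contra! hcon
  refine h.not_free (c a).pos (isNearRainbow_triple hab hc (hcon a rfl).symm
    (hcon b hc.symm).symm hne) (isNearRainbow_pair hab' hc') (p := a') ?_ hfree
  ext x
  grind

theorem cliqueFree_of_forall_adj_ne (hc : ∀ x y, G.Adj x y → c x ≠ c y) :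
    G.CliqueFree (q + 1) :=
  Colorable.cliqueFree ⟨Coloring.mk c fun {x y} => hc x y⟩ q.lt_succ_self

theorem ncard_edgeSet_le_ncard_edgeSet_deleteEdges_sup_edge_sup_edge [Finite V] {x y x' y' : V}
    {e e' : Sym2 V} (hxy : x ≠ y) (hxy' : x' ≠ y') (hadj : ¬ G.Adj x y) (hadj' : ¬ G.Adj x' y')
    (hne : s(x, y) ≠ s(x', y')) :
    G.edgeSet.ncard ≤ (G.deleteEdges {e, e'} ⊔ edge x y ⊔ edge x' y').edgeSet.ncard := by
  have hinsert : (G.deleteEdges {e, e'} ⊔ edge x y ⊔ edge x' y').edgeSet =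
      insert s(x', y') (insert s(x, y) (G.edgeSet \ {e, e'})) := by
    rw [edgeSet_sup, edgeSet_sup, edgeSet_deleteEdges, edgeSet_edge_of_ne hxy,
      edgeSet_edge_of_ne hxy', Set.union_singleton, Set.union_singleton]
  have hnotMem : s(x, y) ∉ G.edgeSet \ {e, e'} := fun h => hadj h.1
  have hnotMem' : s(x', y') ∉ insert s(x, y) (G.edgeSet \ {e, e'}) := by
    rintro (h | h)
    exacts [hne h.symm, hadj' h.1]
  have hpair := Set.ncard_insert_le e {e'}
  rw [Set.ncard_singleton] at hpair
  have hsdiff := Set.le_ncard_sdiff {e, e'} G.edgeSet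
  rw [hinsert, Set.ncard_insert_of_notMem hnotMem', Set.ncard_insert_of_notMem hnotMem]
  lia

variable [Fintype V]

/-- In a graph with two parts, both edges inside the parts can be exchanged for missing edges
between the parts. -/
theorem IsAlmostMultipartite.ncard_edgeSet_le_of_ne {c : V → Fin 2} {C : Fin 2 → Finset V}
    (h : IsAlmostMultipartite G θ c C) (hfree : (cliquePath 2 (2 + 1)).Free G)
    (hab : G.Adj a b) (hc : c a = c b) (hab' : G.Adj a' b') (hc' : c a' = c b')
    (hne : c a' ≠ c a) :
    G.edgeSet.ncard ≤ (turanGraph (Fintype.card V) 2).edgeSet.ncard := by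
  obtain ⟨z, hz, haz⟩ := h.exists_not_adj hfree hab hc hab' hc' hne
  obtain ⟨z', hz', hbz⟩ := h.exists_not_adj hfree hab hc hab'.symm hc'.symm (hc' ▸ hne)
  have hmono : ∀ x y, G.Adj x y → c x = c y → s(x, y) = s(a, b) ∨ s(x, y) = s(a', b') := by
    intro x y hxy hcxy
    by_cases hx : c x = c a
    · exact Or.inl (h.eq_of_ne le_rfl hfree hxy hcxy hab hc (hx ▸ hne) hne)
    · have hx' : c x = c a' := by grind
      exact Or.inr (h.eq_of_ne le_rfl hfree hxy hcxy hab' hc' (hx' ▸ hne.symm) hne.symm)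
  have hcf : (G.deleteEdges {s(a, b), s(a', b')} ⊔ edge a' z ⊔ edge b' z').CliqueFree (2 + 1) := by
    refine cliqueFree_of_forall_adj_ne (c := c) fun x y hxy hcxy => ?_
    rw [sup_adj, sup_adj, deleteEdges_adj, edge_adj, edge_adj] at hxy
    rcases hxy with (⟨hxy, hdel⟩ | hxy) | hxy
    · exact hdel (hmono x y hxy hcxy)
    · grind
    · grind
  refine (ncard_edgeSet_le_ncard_edgeSet_deleteEdges_sup_edge_sup_edge ?_ ?_ haz hbz
    ?_).trans (ncard_edgeSet_le_of_cliqueFree hcf two_pos)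
  · grind
  · grind
  · have := hab'.ne
    grind

theorem IsAlmostMultipartite.eq_of_lt_ncard (h : IsAlmostMultipartite G θ c C) (hq : 2 ≤ q)
    (hfree : (cliquePath 2 (q + 1)).Free G)
    (he : (turanGraph (Fintype.card V) q).edgeSet.ncard < G.edgeSet.ncard)
    (hab : G.Adj a b) (hc : c a = c b) (hab' : G.Adj a' b') (hc' : c a' = c b') :
    s(a, b) = s(a', b') := by
  by_cases hl : ∃ l, l ≠ c a ∧ l ≠ c a'
  · obtain ⟨l, hl, hl'⟩ := hl
    exact h.eq_of_ne hq hfree hab hc hab' hc' hl hl'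
  have huniv : univ ⊆ ({c a, c a'} : Finset (Fin q)) := fun l _ => by
    simpa [or_iff_not_imp_left] using not_exists.1 hl l
  have hcard : q ≤ #{c a, c a'} := by simpa using card_le_card huniv
  have hne : c a' ≠ c a := by
    intro heq
    rw [heq, pair_eq_singleton, card_singleton] at hcard
    lia
  obtain rfl : q = 2 := (hcard.trans card_le_two).antisymm hq
  exact absurd (h.ncard_edgeSet_le_of_ne hfree hab hc hab' hc' hne) he.not_ge

theorem NearTuran.exists_deleteEdges_cliqueFree (h : NearTuran G q m)
    (hn : 64 * (q + 1) ^ 5 ≤ Fintype.card V) (hfree : (cliquePath 2 (q + 1)).Free G)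
    (he : (turanGraph (Fintype.card V) q).edgeSet.ncard < G.edgeSet.ncard) :
    ∃ a b, G.Adj a b ∧ (G.deleteEdges {s(a, b)}).CliqueFree (q + 1) := by
  have hq := h.two_le
  obtain ⟨θ, c, C, hG⟩ := h.exists_isAlmostMultipartite hn hfree
  obtain ⟨a, b, hab, hc⟩ : ∃ a b, G.Adj a b ∧ c a = c b := by
    by_contra! hcon
    exact he.not_ge (ncard_edgeSet_le_of_cliqueFree (cliqueFree_of_forall_adj_ne hcon) (by lia))
  refine ⟨a, b, hab, cliqueFree_of_forall_adj_ne (c := c) fun x y hxy hcxy => ?_⟩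
  rw [deleteEdges_adj] at hxy
  exact hxy.2 (hG.eq_of_lt_ncard hq hfree he hxy.1 hcxy hab hc)

end Monochromatic

section Join

variable {V A A' B B' : Type*} {G : SimpleGraph A} {H : SimpleGraph B} {a a' : A} {b b' : B}

@[simp]
theorem graphJoin_adj_inl_inl : (graphJoin G H).Adj (.inl a) (.inl a') ↔ G.Adj a a' := by
  simp [graphJoin]

@[simp]
theorem graphJoin_adj_inl_inr : (graphJoin G H).Adj (.inl a) (.inr b) := by simp [graphJoin]

@[simp]
theorem graphJoin_adj_inr_inl : (graphJoin G H).Adj (.inr b) (.inl a) := by simp [graphJoin]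

@[simp]
theorem graphJoin_adj_inr_inr : (graphJoin G H).Adj (.inr b) (.inr b') ↔ H.Adj b b' := by
  simp [graphJoin]

/-- The isomorphism of joins with complete graphs induced by a bijection between the vertices of
the complete graphs and an isomorphism of the other factors. -/
def graphJoinTopIso {H' : SimpleGraph B'} (e : A ≃ A') (φ : H ≃g H') :
    graphJoin (⊤ : SimpleGraph A) H ≃g graphJoin (⊤ : SimpleGraph A') H' where
  toEquiv := e.sumCongr φ.toEquiv
  map_rel_iff' := by
    rintro (a | b) (a' | b')
    · simp
    · simp
    · simp
    · simpa using φ.map_adj_iff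

theorem graphJoin_sup_edge (G : SimpleGraph A) (H : SimpleGraph B) (b b' : B) :
    graphJoin G (H ⊔ edge b b') = graphJoin G H ⊔ edge (.inr b) (.inr b') := by
  ext (x | x) (y | y) <;> simp [edge_adj]

theorem ncard_edgeSet_eq_of_iso (φ : G ≃g H) : G.edgeSet.ncard = H.edgeSet.ncard :=
  Nat.card_congr φ.mapEdgeSet

theorem two_mul_ncard_edgeSet_graphJoin_top [Fintype A] [Fintype B] (H : SimpleGraph B) :
    2 * (graphJoin (⊤ : SimpleGraph A) H).edgeSet.ncard + Fintype.card A =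
      Fintype.card A ^ 2 + 2 * (Fintype.card A * Fintype.card B) + 2 * H.edgeSet.ncard := by
  have hl (a : A) : #{y | (graphJoin (⊤ : SimpleGraph A) H).Adj (.inl a) y} + 1 =
      Fintype.card A + Fintype.card B := by
    have hset : ({y | (graphJoin (⊤ : SimpleGraph A) H).Adj (.inl a) y} : Finset (A ⊕ B)) =
        univ.erase (.inl a) := by
      ext (y | y) <;> simp [eq_comm]
    rw [hset, card_erase_add_one (mem_univ _), card_univ, Fintype.card_sum]
  have hr (b : B) : #{y | (graphJoin (⊤ : SimpleGraph A) H).Adj (.inr b) y} =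
      Fintype.card A + #{y | H.Adj b y} := by
    simp only [card_filter, Fintype.sum_sum_type]
    simp
  have hsum := sum_congr (rfl : (univ : Finset A) = univ) fun a _ => hl a
  rw [sum_add_distrib, sum_const, sum_const, card_univ] at hsum
  rw [← sum_card_adj_univ_eq, ← sum_card_adj_univ_eq, Fintype.sum_sum_type]
  simp only [hr, sum_add_distrib, sum_const, card_univ, smul_eq_mul] at hsum ⊢
  linarith

theorem comap_sumCompl_le_graphJoin_induce (G : SimpleGraph V) (s : Set V) :
    G.comap (Equiv.Set.sumCompl s) ≤ graphJoin (⊤ : SimpleGraph s) (G.induce sᶜ) := by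
  rintro (x | x) (y | y) h
  · exact graphJoin_adj_inl_inl.2 fun e => h.ne (congrArg _ e)
  · exact graphJoin_adj_inl_inr
  · exact graphJoin_adj_inr_inl
  · exact graphJoin_adj_inr_inr.2 h

theorem ncard_edgeSet_le_graphJoin_induce [Finite V] (G : SimpleGraph V) (s : Set V) :
    G.edgeSet.ncard ≤ (graphJoin (⊤ : SimpleGraph s) (G.induce sᶜ)).edgeSet.ncard := by
  rw [← ncard_edgeSet_eq_of_iso (Iso.comap (Equiv.Set.sumCompl s) G)]
  exact Set.ncard_le_ncard (edgeSet_mono (comap_sumCompl_le_graphJoin_induce G s)) (Set.toFinite _)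

theorem nonempty_iso_graphJoin_induce [Finite V] {G : SimpleGraph V} {s : Set V}
    (h : (graphJoin (⊤ : SimpleGraph s) (G.induce sᶜ)).edgeSet.ncard ≤ G.edgeSet.ncard) :
    Nonempty (G ≃g graphJoin (⊤ : SimpleGraph s) (G.induce sᶜ)) := by
  rw [← ncard_edgeSet_eq_of_iso (Iso.comap (Equiv.Set.sumCompl s) G)] at h
  rw [← edgeSet_injective (Set.eq_of_subset_of_ncard_le
    (edgeSet_mono (comap_sumCompl_le_graphJoin_induce G s)) h (Set.toFinite _))]
  exact ⟨(Iso.comap (Equiv.Set.sumCompl s) G).symm⟩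

theorem nonempty_iso_sup_edge {V W : Type*} {G : SimpleGraph V} {T : SimpleGraph W} {a b : V}
    (φ : G.deleteEdges {s(a, b)} ≃g T) (hab : G.Adj a b) :
    Nonempty (G ≃g T ⊔ edge (φ a) (φ b)) := by
  refine ⟨φ.toEquiv, fun {x y} => ?_⟩
  have hadj : T.Adj (φ x) (φ y) ↔ _ := φ.map_adj_iff
  change (T ⊔ edge (φ a) (φ b)).Adj (φ x) (φ y) ↔ _
  rw [sup_adj, edge_adj, hadj, deleteEdges_adj]
  simp only [φ.injective.eq_iff, φ.injective.ne_iff, Set.mem_singleton_iff, Sym2.eq_iff]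
  grind [SimpleGraph.adj_comm, SimpleGraph.ne_of_adj]

end Join

section JoinEdgeCount

variable {V : Type*} [Fintype V] {G : SimpleGraph V} {q k : ℕ} {W : Finset V}

theorem two_mul_ncard_edgeSet_joinTuran (n k q : ℕ) :
    2 * (joinTuran n k (q + 1)).edgeSet.ncard + numUniversal k =
      numUniversal k ^ 2 + 2 * (numUniversal k * (n - numUniversal k)) +
        2 * (turanGraph (n - numUniversal k) q).edgeSet.ncard := by
  have h := two_mul_ncard_edgeSet_graphJoin_top (A := Fin (numUniversal k))
    (turanGraph (n - numUniversal k) q)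
  rwa [Fintype.card_fin, Fintype.card_fin] at h

theorem numUniversal_mul_add_le_edgeCountG (n k q : ℕ) :
    numUniversal k * (n - numUniversal k) + (turanGraph (n - numUniversal k) q).edgeSet.ncard ≤
      edgeCountG n k (q + 1) := by
  have h := two_mul_ncard_edgeSet_joinTuran n k q
  have hf := Nat.le_self_pow two_ne_zero (numUniversal k)
  rw [edgeCountG]
  lia

theorem card_compl_coe_finset (hW : #W = numUniversal k) :
    Fintype.card ((W : Set V)ᶜ : Set V) = Fintype.card V - numUniversal k := by
  rw [Fintype.card_compl_set, ← hW]
  simp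

theorem two_mul_ncard_edgeSet_graphJoin_induce (hW : #W = numUniversal k) :
    2 * (graphJoin (⊤ : SimpleGraph (W : Set V)) (G.induce (W : Set V)ᶜ)).edgeSet.ncard +
        numUniversal k =
      numUniversal k ^ 2 + 2 * (numUniversal k * (Fintype.card V - numUniversal k)) +
        2 * (G.induce (W : Set V)ᶜ).edgeSet.ncard := by
  have h := two_mul_ncard_edgeSet_graphJoin_top (A := (W : Set V)) (G.induce (W : Set V)ᶜ)
  have hc : Fintype.card (W : Set V) = numUniversal k := by simpa using hW
  rwa [card_compl_coe_finset hW, hc] at h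

theorem ncard_edgeSet_add_ncard_edgeSet_turanGraph_le (hW : #W = numUniversal k) (q : ℕ) :
    G.edgeSet.ncard + (turanGraph (Fintype.card V - numUniversal k) q).edgeSet.ncard ≤
      (joinTuran (Fintype.card V) k (q + 1)).edgeSet.ncard +
        (G.induce (W : Set V)ᶜ).edgeSet.ncard := by
  have h₁ := two_mul_ncard_edgeSet_joinTuran (Fintype.card V) k q
  have h₂ := two_mul_ncard_edgeSet_graphJoin_induce (G := G) hW
  have h₃ := ncard_edgeSet_le_graphJoin_induce G (W : Set V)
  lia

theorem nonempty_iso_graphJoin_of_ncard_edgeSet (hW : #W = numUniversal k)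
    (h : (joinTuran (Fintype.card V) k (q + 1)).edgeSet.ncard +
        (G.induce (W : Set V)ᶜ).edgeSet.ncard ≤
      G.edgeSet.ncard + (turanGraph (Fintype.card V - numUniversal k) q).edgeSet.ncard)
    {N : ℕ} {T : SimpleGraph (Fin N)} (φ : G.induce (W : Set V)ᶜ ≃g T) :
    Nonempty (G ≃g graphJoin (⊤ : SimpleGraph (Fin (numUniversal k))) T) := by
  have h₁ := two_mul_ncard_edgeSet_joinTuran (Fintype.card V) k q
  have h₂ := two_mul_ncard_edgeSet_graphJoin_induce (G := G) hW
  obtain ⟨ψ⟩ := nonempty_iso_graphJoin_induce (G := G) (s := (W : Set V)) (by lia)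
  exact ⟨ψ.trans (graphJoinTopIso (W.equivFinOfCardEq hW) φ)⟩

theorem eq_edgeCountG_of_cliqueFree_induce (hq : 2 ≤ q) (hk : Odd k) (hW : #W = numUniversal k)
    (hfree : (G.induce (W : Set V)ᶜ).CliqueFree (q + 1))
    (he : edgeCountG (Fintype.card V) k (q + 1) ≤ G.edgeSet.ncard) :
    G.edgeSet.ncard = edgeCountG (Fintype.card V) k (q + 1) ∧
      IsoToGraphG (Fintype.card V) k (q + 1) G := by
  have hle := ncard_edgeSet_le_of_cliqueFree hfree (by lia)
  have hiso := nonempty_iso_turanGraph_of_cliqueFree hfree (by lia)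
  have hadd := ncard_edgeSet_add_ncard_edgeSet_turanGraph_le (G := G) hW q
  rw [card_compl_coe_finset hW] at hle hiso
  rw [edgeCountG, if_neg (Nat.not_even_iff_odd.2 hk)] at he ⊢
  obtain ⟨φ⟩ := hiso (by lia)
  exact ⟨by lia, _, Or.inl ⟨hk, rfl⟩,
    nonempty_iso_graphJoin_of_ncard_edgeSet (q := q) hW (by lia) φ⟩

theorem eq_edgeCountG_of_deleteEdges_cliqueFree_induce (hq : 2 ≤ q) (hk : Even k)
    (hW : #W = numUniversal k) {a b : ((W : Set V)ᶜ : Set V)} (hab : G.Adj a b)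
    (hfree : ((G.induce (W : Set V)ᶜ).deleteEdges {s(a, b)}).CliqueFree (q + 1))
    (he : edgeCountG (Fintype.card V) k (q + 1) ≤ G.edgeSet.ncard) :
    G.edgeSet.ncard = edgeCountG (Fintype.card V) k (q + 1) ∧
      IsoToGraphG (Fintype.card V) k (q + 1) G := by
  have hle := ncard_edgeSet_le_of_cliqueFree hfree (by lia)
  have hiso := nonempty_iso_turanGraph_of_cliqueFree hfree (by lia)
  have hadd := ncard_edgeSet_add_ncard_edgeSet_turanGraph_le (G := G) hW q
  have hdel : ((G.induce (W : Set V)ᶜ).deleteEdges {s(a, b)}).edgeSet.ncard + 1 =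
      (G.induce (W : Set V)ᶜ).edgeSet.ncard := by
    rw [edgeSet_deleteEdges]
    exact Set.ncard_sdiff_singleton_add_one (induce_adj.2 hab) (Set.toFinite _)
  rw [card_compl_coe_finset hW] at hle hiso
  rw [edgeCountG, if_pos hk] at he ⊢
  obtain ⟨φ⟩ := hiso (by lia)
  obtain ⟨ψ⟩ := nonempty_iso_sup_edge φ (induce_adj.2 hab)
  obtain ⟨χ⟩ := nonempty_iso_graphJoin_of_ncard_edgeSet (q := q) hW (by lia) ψ
  rw [graphJoin_sup_edge] at χ
  refine ⟨by lia, _, Or.inr ⟨hk, _, _, ?_, fun h => ?_, rfl⟩, ⟨χ⟩⟩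
  · exact Sum.inr_injective.ne (φ.injective.ne fun e => hab.ne (congrArg _ e))
  · exact (deleteEdges_adj.1 (φ.map_adj_iff.1 (graphJoin_adj_inr_inr.1 h))).2 rfl

end JoinEdgeCount

section CorePart

variable {V : Type*} [Fintype V] {G : SimpleGraph V} {q k m : ℕ}

theorem NearTuran.exists_large_degree (h : NearTuran G q m) (hk : 1 ≤ k)
    (hn : 9 * k ^ 4 * (q + 1) ^ 5 ≤ Fintype.card V) (hfree : (cliquePath k (q + 1)).Free G)
    (he : edgeCountG (Fintype.card V) k (q + 1) ≤ G.edgeSet.ncard) :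
    ∃ W : Finset V, #W = numUniversal k ∧
      (∀ w ∈ W, #(nonNbr G w) + (2 * #W + 4) * (q + 1) ≤ m) ∧
      ∀ w ∈ W, 6 * #(nonNbr G w) ≤ Fintype.card V := by
  rcases le_or_gt k 2 with hk₂ | hk₂
  · exact ⟨∅, by simp only [card_empty, numUniversal]; lia, by simp⟩
  have he' := (numUniversal_mul_add_le_edgeCountG _ k q).trans he
  obtain ⟨W, hW, hdeg⟩ : ∃ W : Finset V, #W = numUniversal k ∧ ∀ w ∈ W,
      #(nonNbr G w) + (2 * numUniversal k + 6) * (q + 1) ≤ m ∧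
        6 * #(nonNbr G w) ≤ Fintype.card V := by
    have hf : 2 * numUniversal k + 1 ≤ k ∧ k ≤ 2 * numUniversal k + 2 := by
      rw [numUniversal]; lia
    rcases h.two_le.eq_or_lt with rfl | hq
    · exact h.exists_large_degree_of_two hk₂ hf.1 hf.2 hn hfree he'
    · exact h.exists_large_degree_of_three_le hq hk₂ hf.1 hf.2 hn hfree he'
  refine ⟨W, hW, fun w hw => (hdeg w hw).1.trans' ?_, fun w hw => (hdeg w hw).2⟩
  rw [hW]
  gcongr
  lia

theorem mul_numUniversal_add_le (hk : 1 ≤ k) (hq : 2 ≤ q) :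
    12 * ((2 * numUniversal k + 4) * (q + 1)) ≤ 9 * k ^ 4 * (q + 1) ^ 5 := by
  have hf : 2 * numUniversal k + 4 ≤ 4 * k := by rw [numUniversal]; lia
  calc 12 * ((2 * numUniversal k + 4) * (q + 1)) ≤ 12 * ((4 * k) * (q + 1)) := by gcongr
    _ ≤ 9 * (2 + 1) ^ 4 * (1 ^ 3 * k) * (q + 1) := by nlinarith [Nat.zero_le (k * (q + 1))]
    _ ≤ 9 * (q + 1) ^ 4 * (k ^ 3 * k) * (q + 1) := by gcongr
    _ = 9 * k ^ 4 * (q + 1) ^ 5 := by ring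

theorem isNClique_map_of_induce {V : Type*} {G : SimpleGraph V} {s : Set V} {T : Finset s} {r : ℕ}
    (hT : (G.induce s).IsNClique r T) : G.IsNClique r (T.map (.subtype _)) :=
  hT.map.mono (map_comap_le _ _)

theorem NearTuran.exists_cliqueFree_induce (h : NearTuran G q m) (hk : Odd k)
    (hn : 9 * k ^ 4 * (q + 1) ^ 5 ≤ Fintype.card V) (hfree : (cliquePath k (q + 1)).Free G)
    (he : edgeCountG (Fintype.card V) k (q + 1) ≤ G.edgeSet.ncard) :
    ∃ W : Finset V, #W = numUniversal k ∧ (G.induce (W : Set V)ᶜ).CliqueFree (q + 1) := by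
  have hq := h.two_le
  obtain ⟨W, hW, hdeg, hdeg'⟩ := h.exists_large_degree hk.pos hn hfree he
  refine ⟨W, hW, fun T hT => ?_⟩
  have hT' := isNClique_map_of_induce hT
  rcases W.eq_empty_or_nonempty with rfl | hne
  · obtain rfl : k = 1 := by
      obtain ⟨j, rfl⟩ := hk
      simp only [card_empty, numUniversal] at hW
      lia
    obtain ⟨p, hp⟩ := card_pos.1 (by rw [hT'.card_eq]; exact q.succ_pos)
    exact (HasCliquePath.of_isClique hT'.isClique hT'.card_eq hp (by lia)).not_free hfree
  · have hk' : 2 * #W + 1 = k := by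
      obtain ⟨j, rfl⟩ := hk
      rw [hW, numUniversal]
      lia
    obtain ⟨A, p, hA⟩ := h.exists_hasCliquePath_two_mul_card_add_one hdeg hdeg' hne le_rfl
      ((hW ▸ mul_numUniversal_add_le hk.pos hq).trans hn) hT'.isClique hT'.card_eq
      (Finset.disjoint_left.2 fun x hx => by
        obtain ⟨y, -, rfl⟩ := mem_map.1 hx
        exact y.2)
    exact (hk' ▸ hA).not_free hfree

theorem NearTuran.exists_free_induce (h : NearTuran G q m) (hk : Even k) (hk₀ : 1 ≤ k)
    (hn : 9 * k ^ 4 * (q + 1) ^ 5 ≤ Fintype.card V) (hfree : (cliquePath k (q + 1)).Free G)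
    (he : edgeCountG (Fintype.card V) k (q + 1) ≤ G.edgeSet.ncard) :
    ∃ W : Finset V, #W = numUniversal k ∧
      (cliquePath 2 (q + 1)).Free (G.induce (W : Set V)ᶜ) := by
  have hq := h.two_le
  obtain ⟨W, hW, hdeg, hdeg'⟩ := h.exists_large_degree hk₀ hn hfree he
  refine ⟨W, hW, fun hcont => ?_⟩
  obtain ⟨T₁, T₂, p, hT₁, hT₂, hp⟩ := exists_isNClique_inter_eq_of_isContained (by lia) hcont
  replace hT₁ := isNClique_map_of_induce hT₁
  replace hT₂ := isNClique_map_of_induce hT₂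
  replace hp : T₁.map (.subtype _) ∩ T₂.map (.subtype _) = {(p : V)} := by
    rw [← map_inter, hp]; rfl
  have hk' : 2 * #W + 2 = k := by
    obtain ⟨j, rfl⟩ := hk
    rw [hW, numUniversal]
    lia
  rcases W.eq_empty_or_nonempty with rfl | hne
  · obtain ⟨A, x, hA⟩ := exists_hasCliquePath_two (by lia) hT₁ hT₂ hp
    obtain rfl : k = 2 := by rw [← hk', card_empty]
    exact hA.not_free hfree
  · obtain ⟨A, x, hA⟩ := h.exists_hasCliquePath_two_mul_card_add_two hdeg hdeg' hne le_rfl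
      ((hW ▸ mul_numUniversal_add_le hk₀ hq).trans hn) hT₁.isClique hT₁.card_eq
      hT₂.isClique hT₂.card_eq hp (Finset.disjoint_left.2 fun x hx => by
        rw [← map_union] at hx
        obtain ⟨y, -, rfl⟩ := mem_map.1 hx
        exact y.2)
    exact (hk' ▸ hA).not_free hfree

theorem exists_nearTuran (hq : 2 ≤ q)
    (hdeg : ∀ v, q * #(nonNbr G v) + 1 ≤ Fintype.card V + q) : ∃ m, NearTuran G q m := by
  have hle := Nat.mul_div_le (Fintype.card V + q - 1) q
  have hlt := Nat.lt_mul_div_succ (Fintype.card V + q - 1) (by lia : 0 < q)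
  refine ⟨(Fintype.card V + q - 1) / q, hq, fun v => ?_, by lia, by lia⟩
  exact (Nat.le_div_iff_mul_le (by lia)).2 (by have := hdeg v; lia)

theorem card_nonNbr_induce_le {s : Set V} [Fintype s] (v : s) :
    #(nonNbr (G.induce s) v) ≤ #(nonNbr G v) :=
  card_le_card_of_injOn (↑) (fun x hx => by simpa using hx) Subtype.val_injective.injOn

theorem mul_pow_add_numUniversal_le (hk : 2 ≤ k) :
    64 * (q + 1) ^ 5 + numUniversal k ≤ 9 * k ^ 4 * (q + 1) ^ 5 := by
  have hf : numUniversal k ≤ k := by rw [numUniversal]; lia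
  have hk₄ : 64 + k ≤ 9 * k ^ 4 := by nlinarith [Nat.pow_le_pow_left hk 3]
  calc 64 * (q + 1) ^ 5 + numUniversal k ≤ 64 * (q + 1) ^ 5 + k * (q + 1) ^ 5 := by
        gcongr
        exact hf.trans (Nat.le_mul_of_pos_right k (by positivity))
    _ = (64 + k) * (q + 1) ^ 5 := by ring
    _ ≤ 9 * k ^ 4 * (q + 1) ^ 5 := by gcongr

theorem eq_edgeCountG_of_card_nonNbr_le (hq : 2 ≤ q) (hk : 1 ≤ k)
    (hn : 9 * k ^ 4 * (q + 1) ^ 5 ≤ Fintype.card V)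
    (hdeg : ∀ v, q * #(nonNbr G v) + 1 ≤ Fintype.card V - numUniversal k + q)
    (hfree : (cliquePath k (q + 1)).Free G)
    (he : edgeCountG (Fintype.card V) k (q + 1) ≤ G.edgeSet.ncard) :
    G.edgeSet.ncard = edgeCountG (Fintype.card V) k (q + 1) ∧
      IsoToGraphG (Fintype.card V) k (q + 1) G := by
  obtain ⟨m, h⟩ := exists_nearTuran hq fun v => (hdeg v).trans (by lia)
  rcases Nat.even_or_odd k with hk' | hk'
  · obtain ⟨W, hW, hWfree⟩ := h.exists_free_induce hk' hk hn hfree he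
    obtain ⟨m', hm'⟩ : ∃ m', NearTuran (G.induce (W : Set V)ᶜ) q m' := by
      refine exists_nearTuran hq fun v => ?_
      rw [card_compl_coe_finset hW]
      exact (hdeg v).trans' (by gcongr; exact card_nonNbr_induce_le v)
    have hlarge := (mul_pow_add_numUniversal_le (k := k) (q := q)
      (by obtain ⟨j, rfl⟩ := hk'; lia)).trans hn
    have hadd := ncard_edgeSet_add_ncard_edgeSet_turanGraph_le (G := G) hW q
    have he' := he
    rw [edgeCountG, if_pos hk'] at he'
    obtain ⟨a, b, hab, hcf⟩ := hm'.exists_deleteEdges_cliqueFree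
      (by rw [card_compl_coe_finset hW]; lia) hWfree (by rw [card_compl_coe_finset hW]; lia)
    exact eq_edgeCountG_of_deleteEdges_cliqueFree_induce hq hk' hW hab hcf he
  · obtain ⟨W, hW, hWfree⟩ := h.exists_cliqueFree_induce hk' hn hfree he
    exact eq_edgeCountG_of_cliqueFree_induce hq hk' hW hWfree he

end CorePart

section MinDegreeReduction

variable {V : Type*} [Fintype V] {G : SimpleGraph V} {q k m : ℕ}

theorem ncard_edgeSet_induce_compl_singleton (G : SimpleGraph V) (v : V) :
    (G.induce {v}ᶜ).edgeSet.ncard + #{y | G.Adj v y} = G.edgeSet.ncard := by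
  have hle := card_le_card (G.incidenceFinset_subset v)
  rw [card_incidenceFinset_eq_degree] at hle
  rw [ncard_edgeSet_eq_card_edgeFinset, ncard_edgeSet_eq_card_edgeFinset,
    card_edgeFinset_induce_compl_singleton, card_edgeFinset_deleteIncidenceSet,
    ← neighborFinset_eq_filter, card_neighborFinset_eq_degree, Nat.sub_add_cancel hle]

theorem two_mul_ncard_edgeSet_add_card_le (G : SimpleGraph V) :
    2 * G.edgeSet.ncard + Fintype.card V ≤ Fintype.card V ^ 2 := by
  rw [← sum_card_adj_univ_eq, sq]
  calc ∑ x, #{y | G.Adj x y} + Fintype.card V = ∑ x, (#{y | G.Adj x y} + 1) := by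
        rw [sum_add_distrib, ← card_eq_sum_ones, card_univ]
    _ ≤ ∑ _x : V, Fintype.card V := sum_le_sum fun x _ => by
        rw [← card_adj_add_card_nonNbr G x]
        exact Nat.add_le_add_left (card_pos.2 ⟨x, by simp⟩) _
    _ = Fintype.card V * Fintype.card V := by rw [sum_const, card_univ, smul_eq_mul]

theorem edgeCountG_succ (hq : 1 ≤ q) (hm : numUniversal k ≤ m) :
    edgeCountG (m + 1) k (q + 1) + (m - numUniversal k) / q = edgeCountG m k (q + 1) + m := by
  have hjoin := two_mul_ncard_edgeSet_joinTuran m k q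
  have hjoin' := two_mul_ncard_edgeSet_joinTuran (m + 1) k q
  have hturan := ncard_edgeSet_turanGraph_succ hq (m - numUniversal k)
  rw [← Nat.sub_add_comm hm] at hturan
  rw [edgeCountG, edgeCountG]
  have hmul : numUniversal k * (m + 1 - numUniversal k) =
      numUniversal k * (m - numUniversal k) + numUniversal k := by
    rw [Nat.sub_add_comm hm, mul_add_one]
  lia

theorem ncard_edgeSet_lt_of_lt (hq : 1 ≤ q) (hV : Fintype.card V = m + 1)
    (hm : numUniversal k ≤ m) {v : V}
    (hv : m + 1 - numUniversal k + q < q * #(nonNbr G v) + 1) :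
    G.edgeSet.ncard + edgeCountG m k (q + 1) <
      (G.induce {v}ᶜ).edgeSet.ncard + edgeCountG (m + 1) k (q + 1) := by
  have hinduce := ncard_edgeSet_induce_compl_singleton G v
  have hdeg := card_adj_add_card_nonNbr G v
  have hsucc := edgeCountG_succ hq hm
  have hnonNbr : (m - numUniversal k) / q + 2 ≤ #(nonNbr G v) := by
    by_contra! hlt
    have hmul : q * #(nonNbr G v) ≤ q * ((m - numUniversal k) / q + 1) := by gcongr; lia
    have hdiv := Nat.mul_div_le (m - numUniversal k) q
    lia
  lia

end MinDegreeReduction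

section Induction

theorem free_induce {V W : Type*} {G : SimpleGraph V} {H : SimpleGraph W} (h : H.Free G)
    (s : Set V) : H.Free (G.induce s) :=
  fun hcont => h (hcont.trans ⟨Copy.induce G s⟩)

variable {V : Type*} [Fintype V] {G : SimpleGraph V} {q k m : ℕ}

theorem numUniversal_le_mul_pow (k q : ℕ) : numUniversal k ≤ 9 * k ^ 4 * (q + 1) ^ 5 :=
  calc numUniversal k ≤ k := by rw [numUniversal]; lia
    _ ≤ k ^ 4 := Nat.le_self_pow (by lia) k
    _ ≤ 9 * k ^ 4 := by lia
    _ ≤ 9 * k ^ 4 * (q + 1) ^ 5 := Nat.le_mul_of_pos_right _ (by positivity)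

/-- Each deletion of a vertex of low degree raises the surplus of `G` over the extremal number by
at least one, but the surplus of the final graph on `N` vertices is at most `N ^ 2 / 2`. -/
theorem ncard_edgeSet_le_or {N : ℕ} (hN : N = 9 * k ^ 4 * (q + 1) ^ 5) (hq : 2 ≤ q) (hk : 1 ≤ k)
    (hm : N ≤ m) (hV : Fintype.card V = m) (hfree : (cliquePath k (q + 1)).Free G) :
    G.edgeSet.ncard ≤ edgeCountG m k (q + 1) ∨
      2 * G.edgeSet.ncard + 2 * (m - N) + N ≤ 2 * edgeCountG m k (q + 1) + N ^ 2 := by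
  have hf := hN ▸ numUniversal_le_mul_pow k q
  induction m, hm using Nat.le_induction generalizing V with
  | base =>
    right
    have hle := two_mul_ncard_edgeSet_add_card_le G
    rw [hV] at hle
    lia
  | succ m hm ih =>
    by_cases hdeg : ∀ v, q * #(nonNbr G v) + 1 ≤ m + 1 - numUniversal k + q
    · left
      by_contra! hlt
      rw [← hV] at hdeg hlt
      exact hlt.ne' (eq_edgeCountG_of_card_nonNbr_le hq hk (by lia) hdeg hfree hlt.le).1
    · push Not at hdeg
      obtain ⟨v, hv⟩ := hdeg
      have hlt := ncard_edgeSet_lt_of_lt (by lia) hV (by lia) hv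
      have hcard : Fintype.card ({v}ᶜ : Set V) = m := by
        rw [Fintype.card_compl_set, hV, Set.card_singleton, Nat.add_sub_cancel]
      rcases ih hcard (free_induce hfree _) with h | h
      · left; lia
      · right; lia

theorem sq_add_le_of_mul_le {n : ℕ} (hq : 2 ≤ q) (hk : 1 ≤ k)
    (hn : 41 * k ^ 8 * (q + 1) ^ 10 ≤ n) :
    (9 * k ^ 4 * (q + 1) ^ 5) ^ 2 + 9 * k ^ 4 * (q + 1) ^ 5 + 3 ≤ 2 * n := by
  have hM : 3 ^ 5 ≤ k ^ 4 * (q + 1) ^ 5 := by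
    calc 3 ^ 5 = 1 ^ 4 * (2 + 1) ^ 5 := by norm_num
      _ ≤ k ^ 4 * (q + 1) ^ 5 := by gcongr
  have hsq : 41 * k ^ 8 * (q + 1) ^ 10 = 41 * (k ^ 4 * (q + 1) ^ 5) ^ 2 := by ring
  rw [hsq] at hn
  rw [mul_assoc]
  nlinarith

theorem ncard_edgeSet_le_edgeCountG (hq : 2 ≤ q) (hk : 1 ≤ k)
    (hn : 41 * k ^ 8 * (q + 1) ^ 10 ≤ Fintype.card V) (hfree : (cliquePath k (q + 1)).Free G) :
    G.edgeSet.ncard ≤ edgeCountG (Fintype.card V) k (q + 1) ∧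
      (G.edgeSet.ncard = edgeCountG (Fintype.card V) k (q + 1) →
        IsoToGraphG (Fintype.card V) k (q + 1) G) := by
  have hsq := sq_add_le_of_mul_le hq hk hn
  have hf := numUniversal_le_mul_pow k q
  obtain ⟨N, hN⟩ : ∃ N, N = 9 * k ^ 4 * (q + 1) ^ 5 := ⟨_, rfl⟩
  rw [← hN] at hsq hf
  have hNN := Nat.le_self_pow two_ne_zero N
  by_cases hdeg : ∀ v, q * #(nonNbr G v) + 1 ≤ Fintype.card V - numUniversal k + q
  · have h := eq_edgeCountG_of_card_nonNbr_le hq hk (by lia) hdeg hfree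
    refine ⟨?_, fun he => (h he.ge).2⟩
    by_contra! hlt
    exact hlt.ne' (h hlt.le).1
  · push Not at hdeg
    obtain ⟨v, hv⟩ := hdeg
    obtain ⟨m, hm⟩ := Nat.exists_eq_succ_of_ne_zero (by lia : Fintype.card V ≠ 0)
    rw [hm, Nat.succ_eq_add_one] at hv hsq ⊢
    have hlt := ncard_edgeSet_lt_of_lt (by lia) hm (by lia) hv
    have hcard : Fintype.card ({v}ᶜ : Set V) = m := by
      rw [Fintype.card_compl_set, hm, Set.card_singleton, Nat.succ_sub_one]
    have hstrict : G.edgeSet.ncard < edgeCountG (m + 1) k (q + 1) := by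
      rcases ncard_edgeSet_le_or hN hq hk (by lia) hcard (free_induce hfree _) with h | h <;> lia
    exact ⟨hstrict.le, fun he => absurd he hstrict.ne⟩

end Induction

section ExtremalGraphs

variable {A B : Type*} {k r n : ℕ}

theorem exists_forall_cliqueOf_mem_range_inr [Fintype A]
    (φ : Fin (k + 1) ⊕ Fin k × Fin (r - 2) ↪ A ⊕ B) :
    ∃ S : Finset (Fin k), (∀ i ∈ S, ∀ x ∈ cliqueOf i, φ x ∈ Set.range Sum.inr) ∧
      k ≤ #S + 2 * Fintype.card A := by
  let X : Finset (Fin (k + 1) ⊕ Fin k × Fin (r - 2)) := {x | φ x ∉ Set.range Sum.inr}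
  have hX : #X ≤ Fintype.card A := by
    rw [← card_map φ, ← card_univ, ← card_map (.inl : A ↪ A ⊕ B)]
    refine card_le_card fun y hy => ?_
    obtain ⟨x, hx, rfl⟩ := mem_map.1 hy
    rcases hφx : φ x with a | b
    · exact mem_map_of_mem _ (mem_univ a)
    · exact absurd ⟨b, hφx.symm⟩ (mem_filter.1 hx).2
  have hsub : ({i | ¬ ∀ x ∈ cliqueOf i, φ x ∈ Set.range Sum.inr} : Finset (Fin k)) ⊆
      X.biUnion fun x => {i | x ∈ cliqueOf i} := by
    intro i hi
    obtain ⟨x, hxi, hx⟩ := not_forall₂.1 (mem_filter.1 hi).2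
    exact mem_biUnion.2 ⟨x, by simpa [X] using hx, by simpa using hxi⟩
  have hcard := (card_le_card hsub).trans
    (card_biUnion_le_card_mul _ _ 2 fun x _ => card_filter_mem_cliqueOf_le_two x)
  have hsum := card_filter_add_card_filter_not (s := (univ : Finset (Fin k)))
    fun i => ∀ x ∈ cliqueOf i, φ x ∈ Set.range Sum.inr
  rw [card_univ, Fintype.card_fin] at hsum
  exact ⟨({i | ∀ x ∈ cliqueOf i, φ x ∈ Set.range Sum.inr} : Finset (Fin k)),
    fun i hi => (mem_filter.1 hi).2, by lia⟩

theorem exists_not_adj_of_cliqueFree {G : SimpleGraph A} {H : SimpleGraph B}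
    (hH : H.CliqueFree r) {T : Finset (A ⊕ B)} (hT : #T = r)
    (hTB : ∀ x ∈ T, x ∈ Set.range Sum.inr) :
    ∃ x ∈ T, ∃ y ∈ T, x ≠ y ∧ ¬ (graphJoin G H).Adj x y := by
  by_contra! hadj
  refine hH (T.preimage Sum.inr Sum.inr_injective.injOn) ⟨fun x hx y hy hne => ?_, ?_⟩
  · rw [coe_preimage] at hx hy
    exact graphJoin_adj_inr_inr.1 (hadj _ hx _ hy (Sum.inr_injective.ne hne))
  · rw [card_preimage, filter_true_of_mem hTB, hT]

theorem exists_mem_cliqueOf_not_adj (hr : 2 ≤ r) {i : Fin k}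
    (φ : Fin (k + 1) ⊕ Fin k × Fin (r - 2) ↪ Fin (numUniversal k) ⊕ Fin (n - numUniversal k))
    (hi : ∀ x ∈ cliqueOf i, φ x ∈ Set.range Sum.inr) :
    ∃ x ∈ cliqueOf i, ∃ y ∈ cliqueOf i, x ≠ y ∧ ¬ (joinTuran n k r).Adj (φ x) (φ y) := by
  have hturan : (turanGraph (n - numUniversal k) (r - 1)).CliqueFree r := by
    have h := turanGraph_cliqueFree (n := n - numUniversal k) (by lia : 0 < r - 1)
    rwa [Nat.sub_add_cancel (by lia)] at h
  have hcard : #(({x | x ∈ cliqueOf i} : Finset _).map φ) = r := by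
    rw [card_map, card_filter_mem_cliqueOf hr]
  obtain ⟨_, hxT, _, hyT, hne, hadj⟩ := exists_not_adj_of_cliqueFree (G := ⊤) hturan hcard
    (by
      simpa only [mem_map, forall_exists_index, and_imp, forall_apply_eq_imp_iff₂, mem_filter_univ]
        using hi)
  obtain ⟨x, hx, rfl⟩ := mem_map.1 hxT
  obtain ⟨y, hy, rfl⟩ := mem_map.1 hyT
  exact ⟨x, (mem_filter.1 hx).2, y, (mem_filter.1 hy).2, ne_of_apply_ne _ hne, hadj⟩

theorem exists_mem_cliqueOf_eq (hr : 2 ≤ r) {a b : Fin (numUniversal k) ⊕ Fin (n - numUniversal k)}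
    (φ : Copy (cliquePath k r) (joinTuran n k r ⊔ edge a b)) {i : Fin k}
    (hi : ∀ x ∈ cliqueOf i, φ x ∈ Set.range Sum.inr) :
    (∃ x ∈ cliqueOf i, φ x = a) ∧ ∃ y ∈ cliqueOf i, φ y = b := by
  obtain ⟨x, hx, y, hy, hne, hadj⟩ := exists_mem_cliqueOf_not_adj hr φ.toEmbedding hi
  have hsup : (joinTuran n k r ⊔ edge a b).Adj (φ x) (φ y) :=
    φ.toHom.map_adj (cliquePath_adj_iff.2 ⟨hne, i, hx, hy⟩)
  rw [sup_adj, edge_adj] at hsup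
  rcases hsup.resolve_left hadj with ⟨⟨hxa, hyb⟩ | ⟨hxb, hya⟩, -⟩
  · exact ⟨⟨x, hx, hxa⟩, y, hy, hyb⟩
  · exact ⟨⟨y, hy, hya⟩, x, hx, hxb⟩

theorem free_of_isGraphG (hk : 1 ≤ k) (hr : 2 ≤ r)
    {H : SimpleGraph (Fin (numUniversal k) ⊕ Fin (n - numUniversal k))} (h : IsGraphG n k r H) :
    (cliquePath k r).Free H := by
  rintro ⟨φ⟩
  obtain ⟨S, hS, hle⟩ := exists_forall_cliqueOf_mem_range_inr φ.toEmbedding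
  have hf : numUniversal k = (k - 1) / 2 := rfl
  rw [Fintype.card_fin] at hle
  rcases h with ⟨hodd, rfl⟩ | ⟨heven, a, b, hab, -, rfl⟩
  · obtain ⟨i, hi⟩ : S.Nonempty := card_pos.1 (by obtain ⟨j, rfl⟩ := hodd; lia)
    obtain ⟨x, hx, y, hy, hne, hadj⟩ := exists_mem_cliqueOf_not_adj hr φ.toEmbedding (hS i hi)
    exact hadj (φ.toHom.map_adj (cliquePath_adj_iff.2 ⟨hne, i, hx, hy⟩))
  · obtain ⟨i, hi, j, hj, hij⟩ := one_lt_card.1 (by obtain ⟨l, rfl⟩ := heven; lia : 1 < #S)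
    obtain ⟨⟨x, hxi, hx⟩, y, hyi, hy⟩ := exists_mem_cliqueOf_eq hr φ (hS i hi)
    obtain ⟨⟨x', hxj, hx'⟩, y', hyj, hy'⟩ := exists_mem_cliqueOf_eq hr φ (hS j hj)
    obtain rfl := φ.injective (hx'.trans hx.symm)
    obtain rfl := φ.injective (hy'.trans hy.symm)
    have hne : x' ≠ y' := by
      rintro rfl
      exact hab (hx.symm.trans hy)
    exact hij (eq_of_mem_cliqueOf hne hxi hyi hxj hyj)

end ExtremalGraphs

end CliquePath

open CliquePath in
theorem theorem2_general (n k r : ℕ) (hk : 1 ≤ k) (hr : 3 ≤ r) (hn : 41 * k ^ 8 * r ^ 10 ≤ n)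
    {V : Type*} [Fintype V] (hV : Fintype.card V = n) (G : SimpleGraph V) :
    ((cliquePath k r).Free G →
      G.edgeSet.ncard ≤ edgeCountG n k r ∧
        (G.edgeSet.ncard = edgeCountG n k r ↔ IsoToGraphG n k r G)) ∧
    (IsoToGraphG n k r G → (cliquePath k r).Free G) := by
  obtain ⟨q, rfl⟩ := Nat.exists_eq_add_of_le' (by lia : 1 ≤ r)
  subst hV
  refine ⟨fun hfree => ?_, fun ⟨H, hH, ⟨φ⟩⟩ => ?_⟩
  · obtain ⟨hle, hiso⟩ := ncard_edgeSet_le_edgeCountG (by lia) hk hn hfree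
    refine ⟨hle, hiso, fun ⟨H, hH, ⟨φ⟩⟩ => ?_⟩
    rw [ncard_edgeSet_eq_of_iso φ, hH.ncard_edgeSet]
  · exact (SimpleGraph.free_congr_right φ).2 (free_of_isGraphG hk (by lia) hH)

theorem theorem2 (n k r : ℕ) (hk : 1 ≤ k) (hr : 3 ≤ r) (hn : 16 * k ^ 8 * r ^ 11 < n)
    {V : Type*} [Fintype V] (hV : Fintype.card V = n) (G : SimpleGraph V) :
    ((cliquePath k r).Free G →
      G.edgeSet.ncard ≤ edgeCountG n k r ∧
        (G.edgeSet.ncard = edgeCountG n k r ↔ IsoToGraphG n k r G)) ∧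
    (IsoToGraphG n k r G → (cliquePath k r).Free G) :=
  theorem2_general n k r hk hr
    (by rw [pow_succ r 10] at hn; nlinarith [Nat.zero_le (k ^ 8 * r ^ 10)]) hV G
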